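/- **Setting.** There is an absolute constant $c>0$ for which the following holds. Let $1\le k<d$ and $1\le m<d$. Let $\mathcal D_0,\mathcal D_1$ be distributions on $\mathbb R^d$ with means $\mu_a$ and covariances $\Sigma_a$, let $p\in(0,1)$, and let $a\sim\mathrm{Bernoulli}(p)$, $x\mid a\sim\mathcal D_a$. The law $\mathcal D=p\mathcal D_1+(1-p)\mathcal D_0$ of $x$ is assumed to be centered; $\Sigma$ is its covariance. Put $f=\mu_1-\mu_0$ and $S=(\Sigma_1+\mu_1\mu_1^\top)-(\Sigma_0+\mu_0\mu_0^\top)$. For a matrix $A$ with orthonormal columns, $\Pi_A=AA^\top$ and $\Pi_A^\perp=I-AA^\top$; $\|\cdot\|$ is the Euclidean norm of vectors and the spectral norm of matrices. Let the columns of $P_m\in\mathbb R^{d\times m}$ be top-$m$ (in magnitude) orthonormal eigenvectors of $S$, let $g=\Pi_{P_m}^\perp f$, and let $U=P_m$ if $g=0$ and $U=[P_m\mid g/\|g\|]$ otherwise. Let the columns of $Q_k\in\mathbb R^{d\times k}$ be top-$k$ (in magnitude) orthonormal eigenvectors of $\Pi_U^\perp\Sigma\Pi_U^\perp$. **Assumptions.**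 There are constants $\sigma,V,\mathcal M,\mathcal V,g_{\min}>0$, $f_{\max}>g_{\min}$, $p_{\min}\in(0,\frac12]$ such that for $a\in\{0,1\}$ $$\Pr_{y\sim\mathcal D_a}\big[\|y-\mu_a\|\ge t\big]\le 2e^{-t^2/(2\sigma^2)}\ \ (t\ge 0),\qquad \Pr\big[\|xx^\top-(\Sigma_a+\mu_a\mu_a^\top)\|\le\mathcal M\,\big|\,a\big]=1,$$ $$\|\Sigma_a+\mu_a\mu_a^\top\|\le V,\qquad \mathrm{Var}(xx^\top\mid a)\le\mathcal V,$$ where $\mathrm{Var}(Z)=\max(\|\mathbb E[YY^\top]\|,\|\mathbb E[Y^\top Y]\|)$ with $Y=Z-\mathbb E Z$; moreover $\|g\|\in\{0\}\cup[g_{\min},f_{\max}]$, $\|f\|\le f_{\max}$ and $p\in[p_{\min},1-p_{\min}]$. There are $\Delta_{m,\nu},\Delta_{k,\kappa},K_{m,\nu},K_{k,\kappa}>0$ such that the singular values $\nu_1\ge\dots\ge\nu_d$ of $S$ and $\kappa_1\ge\dots\ge\kappa_d$ of $\Pi_U^\perp\Sigma\Pi_U^\perp$ satisfy $\nu_m-\nu_{m+1}\ge\Delta_{m,\nu}$,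 $\kappa_k-\kappa_{k+1}\ge\Delta_{k,\kappa}$, $\nu_m\le K_{m,\nu}$, $\kappa_k\le K_{k,\kappa}$. **Algorithms.** $\mathrm{QR}(M)$ denotes the orthonormal factor produced by any fixed (measurable) QR decomposition routine: $\mathrm{QR}(M)$ has orthonormal columns and $M=\mathrm{QR}(M)R$ with $R$ upper triangular. *Algorithm 1* (UnfairSubspace; block size $b$, $T$ iterations) starts with $W_0=\mathrm{QR}(G)$, $G\in\mathbb R^{d\times m}$ having i.i.d. $N(0,1)$ entries. In iteration $t=1,\dots,T$ it receives $b$ new samples $(a_i,x_i)$, forms for each group $a$ the matrix $C_t^{(a)}=\big(\text{average of }x_ix_i^\top\text{ over the samples of the block with }a_i=a\big)W_{t-1}$ (zero if there is none) and sets $W_t=\mathrm{QR}(C_t^{(1)}-C_t^{(0)})$. Let $\hat f$ be the difference of the means over all samples received with $a_i=1$ and with $a_i=0$ (the mean being zero if there are none), and $\hat g=\Pi_{W_T}^\perp\hat f$. The output is $\hat U=W_T$ if $\hat g=0$ and $\hat U=[W_T\mid\hat g/\|\hat g\|]$ otherwise. *Algorithm 2* (block size $\mathcal B$) runs Algorithm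 1 to obtain $\hat U$. Then, independently of that run, it draws $V_0=\mathrm{QR}(G')$, $G'\in\mathbb R^{d\times k}$ with i.i.d. $N(0,1)$ entries, receives fresh i.i.d. samples $\tilde x_1,\tilde x_2,\dots\sim\mathcal D$ (independent of $G'$), and iterates $$V_\tau=\mathrm{QR}\big(\Pi_{\hat U}^\perp\hat\Sigma_\tau\Pi_{\hat U}^\perp V_{\tau-1}\big),\qquad \hat\Sigma_\tau=\frac1{\mathcal B}\sum_{j=(\tau-1)\mathcal B+1}^{\tau\mathcal B}\tilde x_j\tilde x_j^\top ,\qquad \tau\ge 1 .$$ Its noise matrices are $Z_{\tau,2}=\big(\Pi_{\hat U}^\perp\hat\Sigma_\tau\Pi_{\hat U}^\perp-\Pi_U^\perp\Sigma\Pi_U^\perp\big)V_{\tau-1}$. **Claim.** Let $\varepsilon,\delta\in(0,1)$ and suppose that the run of Algorithm 1 has produced $\hat U$ with $$\|\Pi_{\hat U}-\Pi_U\|\le\frac{\Delta_{k,\kappa}}{20V}\min\Big(\varepsilon,\frac{\delta}{2\sqrt{dk}}\Big).$$ If the block size of Algorithm 2 satisfies $$\mathcal B\ \ge\ c\left(\frac{\mathcal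 V+V^2}{\Delta_{k,\kappa}^2}\Big(\frac{dk}{\delta^2}\log\frac{2k}{\delta}+\frac1{\varepsilon^2}\log\frac d\delta\Big)+\frac{\mathcal M^2}{\mathcal V+V^2}\log\frac d\delta\right),$$ then for every $\tau\ge1$, conditionally on the run of Algorithm 1, with probability at least $1-\delta$, $$5\|Z_{\tau,2}\|\le\varepsilon\Delta_{k,\kappa}\qquad\text{and}\qquad 5\|Q_k^\top Z_{\tau,2}\|\le\frac{\delta\Delta_{k,\kappa}}{2\sqrt{dk}} .$$ (For $k\ge2$ or $\delta\le\frac12$, $\log\frac{2k}{\delta}\le 2\log\frac k\delta$, so that then $\log\frac{2k}\delta$ may be replaced by $\log\frac k\delta$ after doubling $c$.) -/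

import Mathlib

open MeasureTheory ProbabilityTheory
-- `‖A‖` denotes the spectral norm of a real matrix `A`.
open scoped Matrix Matrix.Norms.L2Operator

namespace FairPCA

noncomputable section

/-- `ℝ^d` with the Euclidean norm. -/
abbrev Vec (d : ℕ) : Type := EuclideanSpace ℝ (Fin d)

/-- Real `d × r` matrices. -/
abbrev Mat (d r : ℕ) : Type := Matrix (Fin d) (Fin r) ℝ

/-- A data point `(a, x)`; the sensitive attribute `a = 1` is `true` and `a = 0` is `false`. -/
abbrev Sample (d : ℕ) : Type := Bool × Vec d

/-! ### Linear algebra -/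

/-- The rank-one matrix `x xᵀ`. -/
def outer {d : ℕ} (x : Vec d) : Mat d d := Matrix.of fun i j => x i * x j

/-- `Π_U = U Uᵀ`, the orthogonal projection onto `col(U)` when `U` has orthonormal columns. -/
def proj {d r : ℕ} (U : Mat d r) : Mat d d := U * Uᵀ

/-- `Π_U^⊥ = I - U Uᵀ`. -/
def projPerp {d r : ℕ} (U : Mat d r) : Mat d d := 1 - proj U

/-- The singular values of `A` in decreasing order with multiplicity, indexed from `1`. -/
def singVal {d : ℕ} (A : Mat d d) (i : ℕ) : ℝ :=
  (Matrix.toEuclideanLin A).singularValues (i - 1)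

/-- The columns of `Q` are top-`r` (in magnitude) orthonormal eigenvectors of the symmetric
matrix `A`: they are orthonormal, and the `j`-th one is an eigenvector whose eigenvalue has
absolute value the `j`-th largest singular value of `A`. -/
def IsTopEigenvectors {d r : ℕ} (A : Mat d d) (Q : Mat d r) : Prop :=
  Qᵀ * Q = 1 ∧ ∃ lam : Fin r → ℝ,
    A * Q = Q * Matrix.diagonal lam ∧ ∀ j : Fin r, |lam j| = singVal A ((j : ℕ) + 1)

/-- `Π_W^⊥ f`, the component of `f` orthogonal to the columns of `W`. -/
def orthResidual {d m : ℕ} (W : Mat d m) (f : Vec d) : Vec d :=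
  Matrix.toEuclideanLin (projPerp W) f

open Classical in
/-- With `g = Π_W^⊥ f`: the matrix `W` if `g = 0`, and the matrix `[W | g / ‖g‖]` otherwise.
It comes with its number of columns. -/
def adjoin {d m : ℕ} (W : Mat d m) (f : Vec d) : Σ r : ℕ, Mat d r :=
  if orthResidual W f = 0 then ⟨m, W⟩
  else ⟨m + 1, Matrix.of fun i =>
    Fin.snoc (fun j => W i j) (orthResidual W f i / ‖orthResidual W f‖)⟩

/-- `qr` returns the orthonormal factor of a QR decomposition of every `d × r` matrix: a matrix `Q`
with orthonormal columns such that `M = Q R` with `R` upper triangular. (Such a factor is not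
unique, by signs and for rank-deficient matrices; any measurable choice is allowed.) -/
structure IsQR {d r : ℕ} (qr : Mat d r → Mat d r) : Prop where
  measurable : ∀ i j, Measurable fun M : Fin d → Fin r → ℝ =>
    qr (Matrix.of M) i j
  orthonormal : ∀ M, (qr M)ᵀ * qr M = 1
  factor : ∀ M, ∃ R : Mat r r, R.BlockTriangular id ∧ M = qr M * R

/-! ### The data distribution -/

/-- Entrywise expectation of a random matrix. -/
def expMat {α : Type*} [MeasurableSpace α] {r s : ℕ} (μ : Measure α) (Z : α → Mat r s) : Mat r s :=
  Matrix.of fun i j => ∫ w, Z w i j ∂μ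

/-- The scalar variance of a random matrix,
`max (‖E[Y Yᵀ]‖) (‖E[Yᵀ Y]‖)` with `Y = Z - E[Z]`. -/
def matVar {α : Type*} [MeasurableSpace α] {r s : ℕ} (μ : Measure α) (Z : α → Mat r s) : ℝ :=
  max ‖expMat μ fun w => (Z w - expMat μ Z) * (Z w - expMat μ Z)ᵀ‖
    ‖expMat μ fun w => (Z w - expMat μ Z)ᵀ * (Z w - expMat μ Z)‖

/-- The mean of a distribution on `ℝ^d`. -/
def mean {d : ℕ} (μ : Measure (Vec d)) : Vec d := ∫ x, x ∂μ

/-- The covariance matrix of a distribution on `ℝ^d`. -/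
def covMatrix {d : ℕ} (μ : Measure (Vec d)) : Mat d d :=
  Matrix.of fun i j => cov[fun x : Vec d => x i, fun x : Vec d => x j; μ]

/-- The second moment `Σ_a + μ_a μ_aᵀ` of a distribution with mean `μ_a` and covariance `Σ_a`. -/
def secondMoment {d : ℕ} (μ : Measure (Vec d)) : Mat d d := covMatrix μ + outer (mean μ)

/-- The mean difference `f = μ_1 - μ_0`. -/
def meanGap {d : ℕ} (D : Bool → Measure (Vec d)) : Vec d := mean (D true) - mean (D false)

/-- The second moment difference `S`. -/
def momentGap {d : ℕ} (D : Bool → Measure (Vec d)) : Mat d d :=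
  secondMoment (D true) - secondMoment (D false)

/-- The law of `x`: the mixture `p D_1 + (1 - p) D_0`. -/
def mixture {d : ℕ} (D : Bool → Measure (Vec d)) (p : Set.Ioo (0 : ℝ) 1) : Measure (Vec d) :=
  ENNReal.ofReal p • D true + ENNReal.ofReal (1 - p) • D false

/-- The law of `(a, x)` where `a ∼ Bernoulli(p)` and `x | a ∼ D_a`. -/
def sampleLaw {d : ℕ} (D : Bool → Measure (Vec d)) (p : Set.Ioo (0 : ℝ) 1) : Measure (Sample d) :=
  ENNReal.ofReal p • (Measure.dirac true).prod (D true) +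
    ENNReal.ofReal (1 - p) • (Measure.dirac false).prod (D false)

instance {d : ℕ} (D : Bool → Measure (Vec d)) [∀ a, IsProbabilityMeasure (D a)]
    (p : Set.Ioo (0 : ℝ) 1) : IsProbabilityMeasure (sampleLaw D p) := by
  refine ⟨?_⟩
  have h0 : (0 : ℝ) ≤ p := p.2.1.le
  have h1 : (0 : ℝ) ≤ 1 - p := sub_nonneg.2 p.2.2.le
  simp [sampleLaw, ← ENNReal.ofReal_add h0 h1]

/-- `μ` is norm-sub-Gaussian with parameter `σ`. -/
def NormSubGaussian {d : ℕ} (σ : ℝ) (μ : Measure (Vec d)) : Prop :=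
  ∀ t : ℝ, 0 ≤ t →
    μ {y | t ≤ ‖y - mean μ‖} ≤ ENNReal.ofReal (2 * Real.exp (-t ^ 2 / (2 * σ ^ 2)))

/-- The population unfair subspace basis: `U = P_m` if `f ∈ col(P_m)`, and
`U = [P_m | g / ‖g‖]` with `g = Π_{P_m}^⊥ f` otherwise. -/
def unfairBasis {d m : ℕ} (D : Bool → Measure (Vec d)) (P : Mat d m) : Σ r : ℕ, Mat d r :=
  adjoin P (meanGap D)

/-- The matrix `Π_U^⊥ Σ Π_U^⊥`, where `Σ` is the covariance of the whole data distribution. -/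
def fairCov {d m : ℕ} (D : Bool → Measure (Vec d)) (p : Set.Ioo (0 : ℝ) 1) (P : Mat d m) :
    Mat d d :=
  projPerp (unfairBasis D P).2 * covMatrix (mixture D p) * projPerp (unfairBasis D P).2

/-- The constants of the first assumption on the data. -/
structure DataConstants where
  (σ V M Var gmin fmax pmin : ℝ)
  σ_pos : 0 < σ
  V_pos : 0 < V
  M_pos : 0 < M
  Var_pos : 0 < Var
  gmin_pos : 0 < gmin
  gmin_lt_fmax : gmin < fmax
  pmin_pos : 0 < pmin
  pmin_le : pmin ≤ 1 / 2

/-- The first assumption: tails, boundedness, variance, mean separation, group probability. -/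
structure DataAssumption {d m : ℕ} (c : DataConstants) (D : Bool → Measure (Vec d))
    (p : Set.Ioo (0 : ℝ) 1) (P : Mat d m) : Prop where
  subGaussian : ∀ a, NormSubGaussian c.σ (D a)
  bounded : ∀ a, ∀ᵐ x ∂(D a), ‖outer x - secondMoment (D a)‖ ≤ c.M
  moment_le : ∀ a, ‖secondMoment (D a)‖ ≤ c.V
  var_le : ∀ a, matVar (D a) outer ≤ c.Var
  residual_norm : ‖orthResidual P (meanGap D)‖ ∈ ({0} ∪ Set.Icc c.gmin c.fmax : Set ℝ)
  meanGap_le : ‖meanGap D‖ ≤ c.fmax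
  prob_mem : (p : ℝ) ∈ Set.Icc c.pmin (1 - c.pmin)

/-- The constants of the second assumption on the data. -/
structure SpectralConstants where
  (Δν Δκ Kν Kκ : ℝ)
  Δν_pos : 0 < Δν
  Δκ_pos : 0 < Δκ
  Kν_pos : 0 < Kν
  Kκ_pos : 0 < Kκ

/-- The second assumption: with `ν_i` and `κ_i` the singular values of `S` and of
`Π_U^⊥ Σ Π_U^⊥`, the gaps after index `m` and `k` are bounded below, and `ν_m`, `κ_k` above. -/
structure SpectralAssumption {d m : ℕ} (c : SpectralConstants) (k : ℕ)
    (D : Bool → Measure (Vec d)) (p : Set.Ioo (0 : ℝ) 1) (P : Mat d m) : Prop where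
  gap_ν : c.Δν ≤ singVal (momentGap D) m - singVal (momentGap D) (m + 1)
  gap_κ : c.Δκ ≤ singVal (fairCov D p P) k - singVal (fairCov D p P) (k + 1)
  ν_le : singVal (momentGap D) m ≤ c.Kν
  κ_le : singVal (fairCov D p P) k ≤ c.Kκ

/-! ### The two algorithms

Sample `i` (counted from `1` in the pseudocode) is entry `i - 1` of the stream, so the block of
length `b` received in iteration `t ≥ 1` consists of the entries in `[(t - 1) b, t b)`. -/

/-- Indices of the samples received in iteration `t ≥ 1`, for block size `b`. -/
def block (b t : ℕ) : Finset ℕ := Finset.Ico ((t - 1) * b) (t * b)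

/-- Indices of the samples of group `a` received in iteration `t`. -/
def groupBlock {d : ℕ} (s : ℕ → Sample d) (b t : ℕ) (a : Bool) : Finset ℕ :=
  (block b t).filter fun i => (s i).1 = a

/-- The internal state of the first algorithm: the iterate `W_t`, the running group means, and the
numbers of samples seen in each group. -/
structure UnfairState (d m : ℕ) where
  W : Mat d m
  runMean : Bool → Vec d
  count : Bool → ℕ

/-- One iteration of the first algorithm, on the block of samples of iteration `t`. The group block
mean and the group block matrix `C^{(a)}` are zero when the group does not occur in the block. -/
def unfairStep {d m : ℕ} (qr : Mat d m → Mat d m) (b : ℕ) (s : ℕ → Sample d) (t : ℕ)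
    (st : UnfairState d m) : UnfairState d m :=
  let bt : Bool → ℕ := fun a => (groupBlock s b t a).card
  let mt : Bool → Vec d := fun a => (bt a : ℝ)⁻¹ • ∑ i ∈ groupBlock s b t a, (s i).2
  let C : Bool → Mat d m := fun a =>
    (bt a : ℝ)⁻¹ • ∑ i ∈ groupBlock s b t a, outer (s i).2 * st.W
  { W := qr (C true - C false)
    runMean := fun a =>
      ((st.count a : ℝ) / (st.count a + bt a)) • st.runMean a +
        ((bt a : ℝ) / (st.count a + bt a)) • mt a
    count := fun a => st.count a + bt a }

/-- The state of the first algorithm after `t` iterations, started from the matrix `G`. -/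
def unfairState {d m : ℕ} (qr : Mat d m → Mat d m) (b : ℕ) (G : Mat d m) (s : ℕ → Sample d) :
    ℕ → UnfairState d m
  | 0 => { W := qr G, runMean := fun _ => 0, count := fun _ => 0 }
  | t + 1 => unfairStep qr b s (t + 1) (unfairState qr b G s t)

/-- The output `Û` of `UnfairSubspace` with block size `b` and `T` iterations, as a function of the
initial (Gaussian) matrix `G` and of the samples `s` that it receives. -/
def unfairSubspace {d m : ℕ} (qr : Mat d m → Mat d m) (b T : ℕ) (G : Mat d m)
    (s : ℕ → Sample d) : Σ r : ℕ, Mat d r :=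
  let st := unfairState qr b G s T
  adjoin st.W (st.runMean true - st.runMean false)

/-- The sample covariance `Σ̂_τ` of the block of iteration `τ` of the second algorithm. -/
def sampleCov {d : ℕ} (B : ℕ) (s : ℕ → Sample d) (τ : ℕ) : Mat d d :=
  (B : ℝ)⁻¹ • ∑ j ∈ block B τ, outer (s j).2

/-- The iterates `V_τ` of the fair noisy power method with block size `B`, as a function of the
estimate `Û`, the initial (Gaussian) matrix `G` and the samples `s` received after `Û` has been
computed. -/
def fairNPM {d k r : ℕ} (qr : Mat d k → Mat d k) (B : ℕ) (Uhat : Mat d r) (G : Mat d k)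
    (s : ℕ → Sample d) : ℕ → Mat d k
  | 0 => qr G
  | τ + 1 =>
    let V := fairNPM qr B Uhat G s τ
    let V' := V - Uhat * Uhatᵀ * V
    let C := sampleCov B s (τ + 1) * V'
    qr (C - Uhat * Uhatᵀ * C)

/-- The noise matrix `Z_{τ,2} = (Π_Û^⊥ Σ̂_τ Π_Û^⊥ - Π_U^⊥ Σ Π_U^⊥) V_{τ-1}` of iteration `τ ≥ 1`,
where `A = Π_U^⊥ Σ Π_U^⊥`. -/
def noise {d k r : ℕ} (qr : Mat d k → Mat d k) (B : ℕ) (Uhat : Mat d r) (A : Mat d d)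
    (G : Mat d k) (s : ℕ → Sample d) (τ : ℕ) : Mat d k :=
  (projPerp Uhat * sampleCov B s τ * projPerp Uhat - A) * fairNPM qr B Uhat G s (τ - 1)

/-- The law of the randomness of the second algorithm after `Û` has been computed: a `d × k` array
of independent standard Gaussians and, independently of it, an i.i.d. stream of samples. All of it
is independent of the run of the first algorithm. -/
def fairNPMLaw {d : ℕ} (k : ℕ) (D : Bool → Measure (Vec d)) [∀ a, IsProbabilityMeasure (D a)]
    (p : Set.Ioo (0 : ℝ) 1) : Measure ((Fin d → Fin k → ℝ) × (ℕ → Sample d)) :=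
  (Measure.pi fun _ => Measure.pi fun _ => gaussianReal 0 1).prod
    (Measure.infinitePi fun _ => sampleLaw D p)

end

end FairPCA

open FairPCA

/-! Write Π' = Π_Û^⊥, Π = Π_U^⊥ and V = V_{τ-1}. The noise splits exactly (`noise_eq`) as Z = Π'(Σ̂
- Σ)Π'V + (Π'ΣΠ' - ΠΣΠ)V.

The second term is deterministic once Û is fixed. It is at most 2‖Σ‖‖Π' - Π‖, and ‖Σ‖ ≤ V because
centering makes Σ a convex combination of the two group second moments. The accuracy assumed of Û
therefore bounds it by half of each of the two budgets.

The first term is statistical and is controlled by matrix Bernstein in two ways. For ‖Z‖ the factors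
Π' and V are dropped and ‖Σ̂ - Σ‖ is bounded in dimension d, which costs log(d/δ). For ‖QᵀZ‖ the
factors are kept: (Π'Q)ᵀ(Σ̂ - Σ)(Π'V) is only k × k, so the much smaller target costs log(2k/δ)
instead. Here V is random, but it depends only on the Gaussian start and on earlier blocks, hence is
independent of block τ. Each event fails with probability at most δ/2. Conditioning on the run of
Algorithm 1 amounts to treating Û as a fixed matrix with orthonormal columns.

`matrix_bernstein` is proved along the lines of Ahlswede and Winter. Golden–Thompson
(`trace_exp_add_le`) peels off one summand at a time from E tr exp(∑ Y_j), each costing a factor 1 +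
w when E Y² ≤ w; the Hermitian dilation handles rectangular matrices, and Markov's inequality
finishes. The past-dependent factors are handled by `truncate`: a quantity determined by the first n
samples is one that is invariant under truncation at n, and sample n is independent of the truncated
sequence. -/

namespace FairPCA

/-! ### Golden–Thompson inequality, through dyadic trace inequalities and the Lie product formula.
-/

section GoldenThompson

variable {n : Type*} [Fintype n] [DecidableEq n]

/-- Cauchy–Schwarz for the trace in its arithmetic-mean form: expand tr (A - Bᵀ)(A - Bᵀ)ᵀ ≥ 0. -/
theorem two_mul_trace_mul_le {n : Type*} [Fintype n] (A B : Matrix n n ℝ) :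
    2 * (A * B).trace ≤ (A * Aᵀ).trace + (Bᵀ * B).trace := by
  have h := (Matrix.posSemidef_self_mul_conjTranspose (A - Bᵀ)).trace_nonneg
  have h2 : (Bᵀ * Aᵀ).trace = (A * B).trace := by
    rw [← Matrix.transpose_mul, Matrix.trace_transpose]
  simp only [Matrix.conjTranspose_eq_transpose_of_trivial, Matrix.transpose_sub,
    Matrix.transpose_transpose, Matrix.sub_mul, Matrix.mul_sub, Matrix.trace_sub, h2] at h
  linarith

theorem trace_mul_pow_comm (A B : Matrix n n ℝ) (r : ℕ) :
    ((A * B) ^ r).trace = ((B * A) ^ r).trace := by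
  cases r with
  | zero => simp
  | succ r =>
    have h : A * (B * A) ^ r = (A * B) ^ r * A :=
      (show SemiconjBy A (B * A) (A * B) by simp [SemiconjBy, mul_assoc]).pow_right r
    rw [pow_succ, ← mul_assoc, ← h, Matrix.trace_mul_comm, ← mul_assoc, ← pow_succ']

/-- The two statements are proved by a joint induction. With exponent doubled, the first applied to
Z² produces a product of the symmetric matrices ZᵀZ and ZZᵀ, which the second separates and
Cauchy–Schwarz recombines. The second applied to PQ follows from the first, since (PQ)ᵀPQ = QP²Q is
cyclically P²Q². -/
theorem trace_pow_le_of_dyadic (j : ℕ) :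
    (∀ Z : Matrix n n ℝ, (Z ^ 2 ^ (j + 1)).trace ≤ ((Zᵀ * Z) ^ 2 ^ j).trace) ∧
    ∀ P Q : Matrix n n ℝ, Pᵀ = P → Qᵀ = Q →
      ((P * Q) ^ 2 ^ j).trace ≤ (P ^ 2 ^ j * Q ^ 2 ^ j).trace := by
  induction j with
  | zero =>
    refine ⟨fun Z => ?_, fun P Q _ _ => by simp⟩
    have h := two_mul_trace_mul_le Z Z
    rw [Matrix.trace_mul_comm Z Zᵀ] at h
    simp only [zero_add, pow_one, pow_zero, pow_two]
    linarith
  | succ j ih =>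
    obtain ⟨hS, hM⟩ := ih
    refine ⟨fun Z => ?_, fun P Q hP hQ => ?_⟩
    · have hA : (Zᵀ * Z)ᵀ = Zᵀ * Z := by simp
      have hB : (Z * Zᵀ)ᵀ = Z * Zᵀ := by simp
      have h2 := two_mul_trace_mul_le ((Zᵀ * Z) ^ 2 ^ j) ((Z * Zᵀ) ^ 2 ^ j)
      rw [Matrix.transpose_pow, Matrix.transpose_pow, hA, hB, ← pow_add, ← pow_add, ← two_mul,
        ← pow_succ', trace_mul_pow_comm Z Zᵀ] at h2
      calc (Z ^ 2 ^ (j + 1 + 1)).trace = ((Z * Z) ^ 2 ^ (j + 1)).trace := by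
            rw [← pow_two, ← pow_mul, ← pow_succ']
        _ ≤ (((Z * Z)ᵀ * (Z * Z)) ^ 2 ^ j).trace := hS _
        _ = (((Zᵀ * Z) * (Z * Zᵀ)) ^ 2 ^ j).trace := by
            rw [Matrix.transpose_mul, mul_assoc, trace_mul_pow_comm]
            simp only [mul_assoc]
        _ ≤ ((Zᵀ * Z) ^ 2 ^ j * (Z * Zᵀ) ^ 2 ^ j).trace := hM _ _ hA hB
        _ ≤ ((Zᵀ * Z) ^ 2 ^ (j + 1)).trace := by linarith
    · calc ((P * Q) ^ 2 ^ (j + 1)).trace ≤ (((P * Q)ᵀ * (P * Q)) ^ 2 ^ j).trace := hS _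
        _ = ((P ^ 2 * Q ^ 2) ^ 2 ^ j).trace := by
            rw [Matrix.transpose_mul, hP, hQ, mul_assoc, trace_mul_pow_comm]
            simp only [mul_assoc, pow_two]
        _ ≤ ((P ^ 2) ^ 2 ^ j * (Q ^ 2) ^ 2 ^ j).trace :=
            hM _ _ (by rw [Matrix.transpose_pow, hP]) (by rw [Matrix.transpose_pow, hQ])
        _ = (P ^ 2 ^ (j + 1) * Q ^ 2 ^ (j + 1)).trace := by
            rw [← pow_mul, ← pow_mul, ← pow_succ']

theorem norm_pow_sub_pow_le {𝔸 : Type*} [NormedRing 𝔸] {x y : 𝔸} {M : ℝ} (hM : 1 ≤ M)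
    (hx : ‖x‖ ≤ M) (hy : ‖y‖ ≤ M) (N : ℕ) : ‖x ^ N - y ^ N‖ ≤ N * M ^ N * ‖x - y‖ := by
  have hM0 : 0 ≤ M := by linarith
  induction N with
  | zero => simp
  | succ N ih =>
    have hp : ‖y ^ N * (x - y)‖ ≤ M ^ (N + 1) * ‖x - y‖ := by
      rcases Nat.eq_zero_or_pos N with rfl | hN
      · simpa using le_mul_of_one_le_left (norm_nonneg _) hM
      · refine (norm_mul_le _ _).trans (mul_le_mul_of_nonneg_right ?_ (norm_nonneg _))
        calc ‖y ^ N‖ ≤ ‖y‖ ^ N := norm_pow_le' _ hN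
          _ ≤ M ^ N := pow_le_pow_left₀ (norm_nonneg _) hy _
          _ ≤ M ^ (N + 1) := pow_le_pow_right₀ hM (Nat.le_succ N)
    calc ‖x ^ (N + 1) - y ^ (N + 1)‖ = ‖(x ^ N - y ^ N) * x + y ^ N * (x - y)‖ := by
          rw [pow_succ, pow_succ]; congr 1; noncomm_ring
      _ ≤ ‖x ^ N - y ^ N‖ * ‖x‖ + M ^ (N + 1) * ‖x - y‖ :=
          (norm_add_le _ _).trans (add_le_add (norm_mul_le _ _) hp)
      _ ≤ (N * M ^ N * ‖x - y‖) * M + M ^ (N + 1) * ‖x - y‖ := by gcongr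
      _ = ((N + 1 : ℕ) : ℝ) * M ^ (N + 1) * ‖x - y‖ := by push_cast; ring

open NormedSpace Filter Topology in
/-- The **Lie product formula**. -/
theorem tendsto_exp_mul_exp_pow {𝔸 : Type*} [NormedRing 𝔸] [NormOneClass 𝔸] [NormedAlgebra ℝ 𝔸]
    [CompleteSpace 𝔸] (a b : 𝔸) :
    Tendsto (fun N : ℕ => (exp ((N : ℝ)⁻¹ • a) * exp ((N : ℝ)⁻¹ • b)) ^ N) atTop
      (𝓝 (exp (a + b))) := by
  have hexp : ∀ x : 𝔸, ‖exp x‖ ≤ Real.exp ‖x‖ := fun x => by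
    rw [exp_eq_tsum ℝ, Real.exp_eq_exp_ℝ, exp_eq_tsum ℝ]
    refine tsum_of_norm_bounded (expSeries_summable' (𝕂 := ℝ) ‖x‖).hasSum fun i => ?_
    rw [norm_smul, smul_eq_mul, Real.norm_of_nonneg (by positivity)]
    gcongr
    exact norm_pow_le _ _
  -- Both curves have value 1 and derivative a + b at 0, so their difference at 1/N is o(1/N).
  -- Telescoping the N-th powers multiplies it by N and by M^N, which is the constant exp(‖a‖ +
  -- ‖b‖).
  have hd : HasDerivAt (fun t : ℝ => exp (t • a) * exp (t • b) - exp (t • (a + b))) 0 0 := by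
    have h1 := hasDerivAt_exp_smul_const (𝕂 := ℝ) a 0
    have h2 := hasDerivAt_exp_smul_const (𝕂 := ℝ) b 0
    have h3 := hasDerivAt_exp_smul_const (𝕂 := ℝ) (a + b) 0
    exact ((h1.mul h2).sub h3).congr_deriv (by simp)
  have hlim : Tendsto (fun N : ℕ => (N : ℝ) * ‖exp ((N : ℝ)⁻¹ • a) * exp ((N : ℝ)⁻¹ • b) -
      exp ((N : ℝ)⁻¹ • (a + b))‖) atTop (𝓝 0) := by
    have h := (hasDerivAt_iff_tendsto_slope_zero.1 hd).norm
    have hN : Tendsto (fun N : ℕ => (N : ℝ)⁻¹) atTop (𝓝[≠] 0) := by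
      refine tendsto_nhdsWithin_iff.2 ⟨tendsto_inv_atTop_nhds_zero_nat, ?_⟩
      filter_upwards [eventually_gt_atTop 0] with N hN
      simpa using hN.ne'
    have := h.comp hN
    simpa [Function.comp_def, norm_smul] using this
  rw [tendsto_iff_norm_sub_tendsto_zero]
  have hlim2 := hlim.mul_const (Real.exp (‖a‖ + ‖b‖))
  rw [zero_mul] at hlim2
  refine squeeze_zero' (Eventually.of_forall fun _ => norm_nonneg _) ?_ hlim2
  filter_upwards [eventually_gt_atTop 0] with N hN
  have hN0 : (N : ℝ) ≠ 0 := by exact_mod_cast hN.ne'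
  have hNi : (0 : ℝ) ≤ (N : ℝ)⁻¹ := by positivity
  set M := Real.exp ((N : ℝ)⁻¹ * (‖a‖ + ‖b‖)) with hMdef
  have hM : 1 ≤ M := Real.one_le_exp (by positivity)
  have hMN : M ^ N = Real.exp (‖a‖ + ‖b‖) := by
    rw [hMdef, ← Real.exp_nat_mul, ← mul_assoc, mul_inv_cancel₀ hN0, one_mul]
  have hx : ‖exp ((N : ℝ)⁻¹ • a) * exp ((N : ℝ)⁻¹ • b)‖ ≤ M := by
    refine (norm_mul_le _ _).trans ?_
    rw [hMdef, mul_add, Real.exp_add]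
    refine mul_le_mul ((hexp _).trans_eq ?_) ((hexp _).trans_eq ?_) (norm_nonneg _) (by positivity)
    · rw [norm_smul, Real.norm_of_nonneg hNi]
    · rw [norm_smul, Real.norm_of_nonneg hNi]
  have hy : ‖exp ((N : ℝ)⁻¹ • (a + b))‖ ≤ M := by
    refine (hexp _).trans (Real.exp_le_exp.2 ?_)
    rw [norm_smul, Real.norm_of_nonneg hNi]
    gcongr
    exact norm_add_le _ _
  have hpow : exp (a + b) = exp ((N : ℝ)⁻¹ • (a + b)) ^ N := by
    let _ := NormedAlgebra.restrictScalars ℚ ℝ 𝔸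
    rw [← exp_nsmul, ← Nat.cast_smul_eq_nsmul ℝ, smul_smul, mul_inv_cancel₀ hN0, one_smul]
  rw [hpow]
  refine (norm_pow_sub_pow_le hM hx hy N).trans_eq ?_
  rw [hMN]; ring

open NormedSpace Filter Topology in
/-- The **Golden–Thompson inequality** for real symmetric matrices. -/
theorem trace_exp_add_le (A B : Matrix n n ℝ) (hA : Aᵀ = A) (hB : Bᵀ = B) :
    (exp (A + B)).trace ≤ (exp A * exp B).trace := by
  rcases isEmpty_or_nonempty n with h | h
  · simp [Matrix.trace]
  -- Along N = 2^j the left side of the dyadic inequality for exp(A/N), exp(B/N) tends to tr exp(A +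
  -- B), while its right side is tr(exp A exp B) for every j.
  have hlim := (tendsto_exp_mul_exp_pow A B).comp
    (tendsto_pow_atTop_atTop_of_one_lt (α := ℕ) one_lt_two)
  have htr : Continuous (Matrix.trace : Matrix n n ℝ → ℝ) := continuous_id.matrix_trace
  refine le_of_tendsto ((htr.tendsto _).comp hlim) (Eventually.of_forall fun j => ?_)
  have hpow : ∀ C : Matrix n n ℝ, exp (((2 ^ j : ℕ) : ℝ)⁻¹ • C) ^ 2 ^ j = exp C := fun C => by
    rw [← Matrix.exp_nsmul, ← Nat.cast_smul_eq_nsmul ℝ, smul_smul, mul_inv_cancel₀ (by positivity),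
      one_smul]
  have := (trace_pow_le_of_dyadic j).2 (exp (((2 ^ j : ℕ) : ℝ)⁻¹ • A))
    (exp (((2 ^ j : ℕ) : ℝ)⁻¹ • B)) (by rw [← Matrix.exp_transpose, Matrix.transpose_smul, hA])
    (by rw [← Matrix.exp_transpose, Matrix.transpose_smul, hB])
  rwa [hpow, hpow] at this

end GoldenThompson

/-! ### Spectral norm in terms of quadratic forms. -/

section QuadraticForms

variable {m n : Type*} [Fintype m] [Fintype n]

theorem dotProduct_self_eq_norm_sq (x : n → ℝ) : x ⬝ᵥ x = ‖WithLp.toLp 2 x‖ ^ 2 := by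
  rw [EuclideanSpace.norm_sq_eq]
  simp [dotProduct, pow_two]

variable [DecidableEq n]

theorem mulVec_dotProduct_self_le (A : Matrix m n ℝ) (x : n → ℝ) :
    (A *ᵥ x) ⬝ᵥ (A *ᵥ x) ≤ ‖A‖ ^ 2 * (x ⬝ᵥ x) := by
  rw [dotProduct_self_eq_norm_sq, dotProduct_self_eq_norm_sq, ← mul_pow]
  exact pow_le_pow_left₀ (norm_nonneg _) (Matrix.l2_opNorm_mulVec A (WithLp.toLp 2 x)) 2

theorem norm_le_of_mulVec_dotProduct_self_le {A : Matrix m n ℝ} {c : ℝ} (hc : 0 ≤ c)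
    (h : ∀ x : n → ℝ, (A *ᵥ x) ⬝ᵥ (A *ᵥ x) ≤ c ^ 2 * (x ⬝ᵥ x)) : ‖A‖ ≤ c := by
  rw [Matrix.l2_opNorm_def]
  refine ContinuousLinearMap.opNorm_le_bound _ hc fun x => ?_
  have := h x.ofLp
  rw [dotProduct_self_eq_norm_sq, dotProduct_self_eq_norm_sq, ← mul_pow] at this
  exact le_of_sq_le_sq this (by positivity)

end QuadraticForms

/-! ### Functional calculus of symmetric matrices under the trace. -/

section Spectral

variable {n : Type*} [Fintype n] [DecidableEq n]

theorem exists_spectral_decomposition (H : Matrix n n ℝ) (hH : Hᵀ = H) :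
    ∃ (U : Matrix n n ℝ) (l : n → ℝ), Uᵀ * U = 1 ∧ U * Uᵀ = 1 ∧
      H = U * Matrix.diagonal l * Uᵀ ∧
      NormedSpace.exp H = U * Matrix.diagonal (fun i => Real.exp (l i)) * Uᵀ ∧
      ∀ i, |l i| ≤ ‖H‖ := by
  have hH' : H.IsHermitian := hH
  have h1 := Unitary.coe_star_mul_self hH'.eigenvectorUnitary
  have h3 := hH'.spectral_theorem
  rw [Unitary.conjStarAlgAut_apply] at h3
  set U : Matrix n n ℝ := (hH'.eigenvectorUnitary : Matrix n n ℝ) with hU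
  have h2 : U * star U = 1 := Unitary.coe_mul_star_self hH'.eigenvectorUnitary
  rw [Matrix.star_eq_conjTranspose, Matrix.conjTranspose_eq_transpose_of_trivial] at h1 h2 h3
  have h3' : H = U * Matrix.diagonal hH'.eigenvalues * Uᵀ := h3
  have hinv : U⁻¹ = Uᵀ := Matrix.inv_eq_left_inv h1
  refine ⟨U, hH'.eigenvalues, h1, h2, h3', ?_, fun i => ?_⟩
  · conv_lhs => rw [h3', ← hinv]
    rw [Matrix.exp_conj _ _ (IsUnit.of_mul_eq_one _ h2), Matrix.exp_diagonal, hinv]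
    congr 3
    ext i
    rw [Pi.coe_exp, Real.exp_eq_exp_ℝ]
  · have : Nonempty n := ⟨i⟩
    simpa using spectrum.norm_le_norm_of_mem (hH'.eigenvalues_mem_spectrum_real i)

theorem dotProduct_conj_diagonal_mulVec (U : Matrix n n ℝ) (l x : n → ℝ) :
    x ⬝ᵥ ((U * Matrix.diagonal l * Uᵀ) *ᵥ x) = ∑ i, l i * (Uᵀ *ᵥ x) i ^ 2 := by
  rw [← Matrix.mulVec_mulVec, ← Matrix.mulVec_mulVec, Matrix.dotProduct_mulVec,
    ← Matrix.mulVec_transpose]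
  simp only [dotProduct, Matrix.mulVec_diagonal]
  exact Finset.sum_congr rfl fun i _ => by ring

theorem sum_transpose_mulVec_sq {U : Matrix n n ℝ} (hU : U * Uᵀ = 1) (x : n → ℝ) :
    ∑ i, (Uᵀ *ᵥ x) i ^ 2 = x ⬝ᵥ x := by
  have h := dotProduct_conj_diagonal_mulVec U (fun _ => 1) x
  rw [Matrix.diagonal_one, mul_one, hU, Matrix.one_mulVec] at h
  simpa using h.symm

/-- Eigenvalue by eigenvalue this is e^s ≤ 1 + s + s² for |s| ≤ 1. The Loewner order is expressed by
quadratic forms throughout. -/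
theorem dotProduct_exp_mulVec_le {Y : Matrix n n ℝ} (hY : Yᵀ = Y) (hY1 : ‖Y‖ ≤ 1) (x : n → ℝ) :
    x ⬝ᵥ (NormedSpace.exp Y *ᵥ x) ≤ x ⬝ᵥ ((1 + Y + Y * Y) *ᵥ x) := by
  obtain ⟨U, l, h1, h2, h3, h4, h5⟩ := exists_spectral_decomposition Y hY
  have h6 : 1 + Y + Y * Y = U * Matrix.diagonal (fun i => 1 + l i + l i ^ 2) * Uᵀ := by
    have hd : Matrix.diagonal (fun i => 1 + l i + l i ^ 2) =
        1 + Matrix.diagonal l + Matrix.diagonal l * Matrix.diagonal l := by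
      rw [Matrix.diagonal_mul_diagonal, ← Matrix.diagonal_one, Matrix.diagonal_add,
        Matrix.diagonal_add]
      simp [pow_two]
    have hYY : Y * Y = U * (Matrix.diagonal l * Matrix.diagonal l) * Uᵀ := by
      calc Y * Y = U * Matrix.diagonal l * (Uᵀ * U) * Matrix.diagonal l * Uᵀ := by
            conv_lhs => rw [h3]
            simp only [mul_assoc]
        _ = _ := by rw [h1]; simp only [mul_assoc, one_mul]
    rw [hd, hYY, mul_add, mul_add, add_mul, add_mul, mul_one, h2, ← h3]
  rw [h4, h6, dotProduct_conj_diagonal_mulVec, dotProduct_conj_diagonal_mulVec]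
  refine Finset.sum_le_sum fun i _ => mul_le_mul_of_nonneg_right ?_ (sq_nonneg _)
  have := (abs_le.1 (Real.abs_exp_sub_one_sub_id_le ((h5 i).trans hY1))).2
  linarith

/-- Jensen: the squared coordinates of a unit vector in an eigenbasis are probability weights, each
at most 1. -/
theorem exp_dotProduct_mulVec_le_trace {H : Matrix n n ℝ} (hH : Hᵀ = H) {x : n → ℝ}
    (hx : x ⬝ᵥ x = 1) : Real.exp (x ⬝ᵥ (H *ᵥ x)) ≤ (NormedSpace.exp H).trace := by
  obtain ⟨U, l, h1, h2, h3, h4, -⟩ := exists_spectral_decomposition H hH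
  have hs := sum_transpose_mulVec_sq h2 x
  have htr : (NormedSpace.exp H).trace = ∑ i, Real.exp (l i) := by
    rw [h4, Matrix.trace_mul_comm, ← mul_assoc, h1, one_mul, Matrix.trace_diagonal]
  rw [hx] at hs
  have hq : x ⬝ᵥ (H *ᵥ x) = ∑ i, l i * (Uᵀ *ᵥ x) i ^ 2 := by
    conv_lhs => rw [h3]
    exact dotProduct_conj_diagonal_mulVec U l x
  have hj := convexOn_exp.map_sum_le (t := Finset.univ) (w := fun i => (Uᵀ *ᵥ x) i ^ 2) (p := l)
    (fun i _ => sq_nonneg _) hs (fun i _ => Set.mem_univ _)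
  rw [hq, htr]
  simp only [smul_eq_mul] at hj
  calc Real.exp (∑ i, l i * (Uᵀ *ᵥ x) i ^ 2) = Real.exp (∑ i, (Uᵀ *ᵥ x) i ^ 2 * l i) := by
        simp only [mul_comm]
    _ ≤ _ := hj
    _ ≤ ∑ i, Real.exp (l i) := Finset.sum_le_sum fun i hi =>
        mul_le_of_le_one_left (Real.exp_pos _).le
          (hs ▸ Finset.single_le_sum (f := fun i => (Uᵀ *ᵥ x) i ^ 2) (fun j _ => sq_nonneg _) hi)

theorem trace_exp_nonneg {H : Matrix n n ℝ} (hH : Hᵀ = H) : 0 ≤ (NormedSpace.exp H).trace := by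
  rcases isEmpty_or_nonempty n with h | ⟨⟨i⟩⟩
  · simp [Matrix.trace]
  · exact (Real.exp_pos _).le.trans
      (exp_dotProduct_mulVec_le_trace hH (x := Pi.single i 1) (by simp))

/-- The soft maximum log tr exp H dominates the largest eigenvalue; reduce to unit vectors by
homogeneity. -/
theorem dotProduct_mulVec_le_log_trace_exp {H : Matrix n n ℝ} (hH : Hᵀ = H) (x : n → ℝ) :
    x ⬝ᵥ (H *ᵥ x) ≤ Real.log (NormedSpace.exp H).trace * (x ⬝ᵥ x) := by
  rcases eq_or_ne x 0 with rfl | hx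
  · simp
  have h0 : 0 < x ⬝ᵥ x := by
    rw [dotProduct_self_eq_norm_sq]
    have : WithLp.toLp 2 x ≠ 0 := by simpa using hx
    positivity
  have hs : √(x ⬝ᵥ x) * √(x ⬝ᵥ x) = x ⬝ᵥ x := Real.mul_self_sqrt h0.le
  have hs0 : √(x ⬝ᵥ x) ≠ 0 := (Real.sqrt_pos.2 h0).ne'
  have h1 := exp_dotProduct_mulVec_le_trace hH (x := (√(x ⬝ᵥ x))⁻¹ • x) (by
    rw [smul_dotProduct, dotProduct_smul, smul_eq_mul, smul_eq_mul]
    nth_rewrite 3 [← hs]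
    field_simp)
  rw [← Real.le_log_iff_exp_le ((Real.exp_pos _).trans_le h1), Matrix.mulVec_smul,
    smul_dotProduct, dotProduct_smul, smul_eq_mul, smul_eq_mul, ← mul_assoc, ← mul_inv, hs,
    inv_mul_le_iff₀ h0] at h1
  linarith

theorem trace_transpose_mul_mul {n : Type*} [Fintype n] (B M : Matrix n n ℝ) :
    (Bᵀ * M * B).trace = ∑ i, B.col i ⬝ᵥ (M *ᵥ B.col i) := by
  rw [mul_assoc]
  simp only [Matrix.trace, Matrix.diag_apply, Matrix.mul_apply, dotProduct, Matrix.mulVec,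
    Matrix.transpose_apply, Matrix.col_apply]

/-- The exponential of a symmetric matrix is the Gram matrix of some square matrix. -/
theorem exists_exp_eq_mul_transpose {H : Matrix n n ℝ} (hH : Hᵀ = H) :
    ∃ B : Matrix n n ℝ, NormedSpace.exp H = B * Bᵀ := by
  refine ⟨NormedSpace.exp ((2 : ℝ)⁻¹ • H), ?_⟩
  rw [← Matrix.exp_transpose, Matrix.transpose_smul, hH, ← pow_two, ← Matrix.exp_nsmul,
    ← Nat.cast_smul_eq_nsmul ℝ, smul_smul]
  simp

/-- After Golden–Thompson, the factorization exp H = BBᵀ turns tr(exp H · M) into a sum of quadratic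
forms of M at the columns of B, where the bound exp Y ≤ 1 + Y + Y² applies termwise. -/
theorem trace_exp_add_le_of_norm_le_one {H Y B : Matrix n n ℝ} (hH : Hᵀ = H) (hY : Yᵀ = Y)
    (hY1 : ‖Y‖ ≤ 1) (hB : NormedSpace.exp H = B * Bᵀ) :
    (NormedSpace.exp (H + Y)).trace ≤
      (NormedSpace.exp H).trace + (NormedSpace.exp H * Y).trace +
        ∑ i, (Y *ᵥ B.col i) ⬝ᵥ (Y *ᵥ B.col i) := by
  refine (trace_exp_add_le H Y hH hY).trans ?_
  have hcyc : ∀ M : Matrix n n ℝ, (NormedSpace.exp H * M).trace = ∑ i, B.col i ⬝ᵥ (M *ᵥ B.col i) := by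
    intro M
    rw [hB, ← trace_transpose_mul_mul, mul_assoc, Matrix.trace_mul_comm]
  have hYY : ∑ i, (Y *ᵥ B.col i) ⬝ᵥ (Y *ᵥ B.col i) = (NormedSpace.exp H * (Y * Y)).trace := by
    rw [hcyc]
    refine Finset.sum_congr rfl fun i _ => ?_
    rw [← Matrix.mulVec_mulVec, Matrix.dotProduct_mulVec (B.col i), ← Matrix.mulVec_transpose, hY]
  have : (NormedSpace.exp H).trace + (NormedSpace.exp H * Y).trace +
      (NormedSpace.exp H * (Y * Y)).trace = (NormedSpace.exp H * (1 + Y + Y * Y)).trace := by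
    rw [mul_add, mul_add, mul_one, Matrix.trace_add, Matrix.trace_add]
  rw [hYY, this, hcyc, hcyc]
  exact Finset.sum_le_sum fun i _ => dotProduct_exp_mulVec_le hY hY1 _

end Spectral

/-! ### Hermitian dilation: from symmetric to rectangular matrices. -/

section Dilation

variable {l r : Type*}

/-- The Hermitian dilation of a rectangular matrix. -/
def dilation (Y : Matrix l r ℝ) : Matrix (l ⊕ r) (l ⊕ r) ℝ := Matrix.fromBlocks 0 Y Yᵀ 0

theorem transpose_dilation (Y : Matrix l r ℝ) : (dilation Y)ᵀ = dilation Y := by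
  simp [dilation, Matrix.fromBlocks_transpose]

theorem dilation_add (Y Z : Matrix l r ℝ) : dilation (Y + Z) = dilation Y + dilation Z := by
  simp [dilation, Matrix.fromBlocks_add]

theorem dilation_smul (c : ℝ) (Y : Matrix l r ℝ) : dilation (c • Y) = c • dilation Y := by
  simp [dilation, Matrix.fromBlocks_smul]

theorem dilation_zero : dilation (0 : Matrix l r ℝ) = 0 := by
  simp [dilation]

variable [Fintype l] [Fintype r]

theorem dotProduct_sum_elim (a b : l → ℝ) (c d : r → ℝ) :
    Sum.elim a c ⬝ᵥ Sum.elim b d = a ⬝ᵥ b + c ⬝ᵥ d := by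
  simp [dotProduct]

theorem dilation_mulVec (Y : Matrix l r ℝ) (u : l ⊕ r → ℝ) :
    dilation Y *ᵥ u = Sum.elim (Y *ᵥ (u ∘ Sum.inr)) (Yᵀ *ᵥ (u ∘ Sum.inl)) := by
  simp [dilation, Matrix.fromBlocks_mulVec]

theorem dotProduct_self_sum (u : l ⊕ r → ℝ) :
    u ⬝ᵥ u = (u ∘ Sum.inl) ⬝ᵥ (u ∘ Sum.inl) + (u ∘ Sum.inr) ⬝ᵥ (u ∘ Sum.inr) := by
  simp [dotProduct]

variable [DecidableEq l] [DecidableEq r]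

theorem norm_transpose (Y : Matrix l r ℝ) : ‖Yᵀ‖ = ‖Y‖ := by
  rw [← Matrix.conjTranspose_eq_transpose_of_trivial, Matrix.l2_opNorm_conjTranspose]

theorem norm_dilation_le (Y : Matrix l r ℝ) : ‖dilation Y‖ ≤ ‖Y‖ := by
  refine norm_le_of_mulVec_dotProduct_self_le (norm_nonneg _) fun u => ?_
  have h1 := mulVec_dotProduct_self_le Y (u ∘ Sum.inr)
  have h2 := mulVec_dotProduct_self_le Yᵀ (u ∘ Sum.inl)
  rw [norm_transpose] at h2
  rw [dilation_mulVec, dotProduct_sum_elim, dotProduct_self_sum]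
  linarith

/-- The largest eigenvalue of the dilation controls ‖S‖: test its quadratic form, bounded by T = log
tr exp, on the vectors (c·Sx, x). A coordinate vector gives T ≥ 0, because the diagonal of the
dilation vanishes. -/
theorem exp_norm_le_trace_exp_dilation [Nonempty l] (S : Matrix l r ℝ) :
    Real.exp ‖S‖ ≤ (NormedSpace.exp (dilation S)).trace := by
  have hq := dotProduct_mulVec_le_log_trace_exp (transpose_dilation S)
  set T := Real.log (NormedSpace.exp (dilation S)).trace with hT
  have h1 : 1 ≤ (NormedSpace.exp (dilation S)).trace := by
    obtain ⟨i⟩ := ‹Nonempty l›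
    have := exp_dotProduct_mulVec_le_trace (transpose_dilation S)
      (x := Pi.single (Sum.inl i) 1) (by simp)
    simpa [dilation] using this
  rw [← Real.le_log_iff_exp_le (by linarith), ← hT]
  have hT0 : 0 ≤ T := Real.log_nonneg h1
  refine norm_le_of_mulVec_dotProduct_self_le hT0 fun x => ?_
  have key : ∀ c : ℝ, 2 * c * ((S *ᵥ x) ⬝ᵥ (S *ᵥ x)) ≤
      T * (c ^ 2 * ((S *ᵥ x) ⬝ᵥ (S *ᵥ x)) + x ⬝ᵥ x) := by
    intro c
    have h := hq (Sum.elim (c • (S *ᵥ x)) x)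
    rw [dilation_mulVec, dotProduct_sum_elim, dotProduct_sum_elim, Sum.elim_comp_inl,
      Sum.elim_comp_inr, Matrix.dotProduct_mulVec x, Matrix.vecMul_transpose,
      dotProduct_smul, smul_dotProduct, smul_dotProduct, dotProduct_smul] at h
    simp only [smul_eq_mul] at h
    linarith
  -- The best choice is c = 1/T, which gives |Sx|² ≤ T²|x|². If T = 0, any positive c forces Sx = 0.
  rcases hT0.eq_or_lt with h0 | h0
  · have := key 1
    rw [← h0] at this ⊢
    linarith
  · have := key T⁻¹
    have h2 : T⁻¹ * ((S *ᵥ x) ⬝ᵥ (S *ᵥ x)) ≤ T * (x ⬝ᵥ x) := by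
      have : T * (T⁻¹ ^ 2 * ((S *ᵥ x) ⬝ᵥ (S *ᵥ x)) + x ⬝ᵥ x) =
        T⁻¹ * ((S *ᵥ x) ⬝ᵥ (S *ᵥ x)) + T * (x ⬝ᵥ x) := by field_simp
      linarith
    rw [inv_mul_le_iff₀ h0] at h2
    linarith

end Dilation

/-! ### Exponential moments of sums of random matrices. -/

section RandomMatrix

/-- Measurability of random matrices is always stated entry by entry; this transfers it to norms and
to traces of exponentials. -/
theorem measurable_comp_of_entries {Ω m n : Type*} [MeasurableSpace Ω] [Finite m] [Finite n]
    {φ : Matrix m n ℝ → ℝ} (hφ : Continuous φ) {Z : Ω → Matrix m n ℝ}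
    (hZ : ∀ i j, Measurable fun ω => Z ω i j) : Measurable fun ω => φ (Z ω) :=
  have hφ' : Continuous (fun M : m → n → ℝ => φ (Matrix.of M)) := hφ
  hφ'.measurable.comp (measurable_pi_iff.2 fun i => measurable_pi_iff.2 fun j => hZ i j)

theorem abs_apply_le_norm {m n : Type*} [Fintype m] [Fintype n] [DecidableEq n]
    (A : Matrix m n ℝ) (i : m) (j : n) : |A i j| ≤ ‖A‖ := by
  have h := mulVec_dotProduct_self_le A (Pi.single j 1)
  rw [Matrix.mulVec_single_one, single_one_dotProduct, Pi.single_eq_same, mul_one] at h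
  refine abs_le_of_sq_le_sq (le_trans ?_ h) (norm_nonneg _)
  rw [pow_two]
  exact Finset.single_le_sum (f := fun i => A.col j i * A.col j i)
    (fun a _ => mul_self_nonneg _) (Finset.mem_univ i)

theorem mulVec_dotProduct_self_le_of_norm_le_one {m n : Type*} [Fintype m] [Fintype n]
    [DecidableEq n] {A : Matrix m n ℝ} (hA : ‖A‖ ≤ 1) (x : n → ℝ) :
    (A *ᵥ x) ⬝ᵥ (A *ᵥ x) ≤ x ⬝ᵥ x := by
  refine (mulVec_dotProduct_self_le A x).trans (mul_le_of_le_one_left ?_ ?_)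
  · rw [dotProduct_self_eq_norm_sq]; positivity
  · exact pow_le_one₀ (norm_nonneg _) hA

variable {E : Type*} [MeasurableSpace E] {ν : Measure E} [IsProbabilityMeasure ν]

theorem integrable_apply_of_norm_le {m n : Type*} [Fintype m] [Fintype n] [DecidableEq n]
    {Y : E → Matrix m n ℝ} (hm : ∀ i j, Measurable fun x => Y x i j) {L : ℝ}
    (hL : ∀ᵐ x ∂ν, ‖Y x‖ ≤ L) (i : m) (j : n) : Integrable (fun x => Y x i j) ν :=
  Integrable.of_bound (hm i j).aestronglyMeasurable L <| by
    filter_upwards [hL] with x hx using (abs_apply_le_norm _ i j).trans hx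

theorem integrable_mulVec_dotProduct_self {m n : Type*} [Fintype m] [Fintype n] [DecidableEq n]
    {Y : E → Matrix m n ℝ} (hm : ∀ i j, Measurable fun x => Y x i j) {L : ℝ}
    (hL : ∀ᵐ x ∂ν, ‖Y x‖ ≤ L) (u : n → ℝ) :
    Integrable (fun x => (Y x *ᵥ u) ⬝ᵥ (Y x *ᵥ u)) ν := by
  have hc : Continuous fun M : Matrix m n ℝ => (M *ᵥ u) ⬝ᵥ (M *ᵥ u) := by fun_prop
  refine Integrable.of_bound (measurable_comp_of_entries hc hm).aestronglyMeasurable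
    (L ^ 2 * (u ⬝ᵥ u)) ?_
  filter_upwards [hL] with x hx
  have h0 : 0 ≤ u ⬝ᵥ u := by rw [dotProduct_self_eq_norm_sq]; positivity
  have h1 : 0 ≤ (Y x *ᵥ u) ⬝ᵥ (Y x *ᵥ u) := by rw [dotProduct_self_eq_norm_sq]; positivity
  rw [Real.norm_of_nonneg h1]
  exact (mulVec_dotProduct_self_le _ u).trans (by gcongr)

theorem continuous_trace_exp {n : Type*} [Fintype n] [DecidableEq n] :
    Continuous fun M : Matrix n n ℝ => (NormedSpace.exp M).trace := by
  let _ := NormedAlgebra.restrictScalars ℚ ℝ (Matrix n n ℝ)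
  exact (NormedSpace.exp_continuous (𝔸 := Matrix n n ℝ)).matrix_trace

/-- One step of the recursion: the linear term vanishes by centering, and the quadratic term is at
most w times the sum of the squared lengths of the columns of B, which is tr exp H. -/
theorem lintegral_trace_exp_add_le {n : Type*} [Fintype n] [DecidableEq n]
    {Y : E → Matrix n n ℝ} (hm : ∀ i j, Measurable fun x => Y x i j) (hs : ∀ x, (Y x)ᵀ = Y x)
    (h1 : ∀ᵐ x ∂ν, ‖Y x‖ ≤ 1) (h0 : ∀ i j, ∫ x, Y x i j ∂ν = 0) {w : ℝ}
    (hw : ∀ u, ∫ x, (Y x *ᵥ u) ⬝ᵥ (Y x *ᵥ u) ∂ν ≤ w * (u ⬝ᵥ u))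
    {H : Matrix n n ℝ} (hH : Hᵀ = H) :
    ∫⁻ x, ENNReal.ofReal (NormedSpace.exp (H + Y x)).trace ∂ν ≤
      ENNReal.ofReal ((1 + w) * (NormedSpace.exp H).trace) := by
  obtain ⟨B, hB⟩ := exists_exp_eq_mul_transpose hH
  have hint := integrable_apply_of_norm_le hm h1
  have hint2 := integrable_mulVec_dotProduct_self hm h1
  have hlin : ∀ x, (NormedSpace.exp H * Y x).trace =
      ∑ i, ∑ j, NormedSpace.exp H i j * Y x j i := fun x => by
    simp [Matrix.trace, Matrix.mul_apply]
  have hI1 : Integrable (fun x => (NormedSpace.exp H * Y x).trace) ν := by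
    simp only [hlin]
    exact integrable_finsetSum _ fun i _ => integrable_finsetSum _ fun j _ =>
      (hint j i).const_mul _
  have hI2 : Integrable (fun x => ∑ i, (Y x *ᵥ B.col i) ⬝ᵥ (Y x *ᵥ B.col i)) ν :=
    integrable_finsetSum _ fun i _ => hint2 _
  have hE1 : ∫ x, (NormedSpace.exp H * Y x).trace ∂ν = 0 := by
    simp only [hlin]
    refine (integral_finsetSum _ fun i _ => integrable_finsetSum _ fun j _ =>
      (hint j i).const_mul _).trans (Finset.sum_eq_zero fun i _ => ?_)
    refine (integral_finsetSum _ fun j _ => (hint j i).const_mul _).trans ?_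
    exact Finset.sum_eq_zero fun j _ => by rw [integral_const_mul, h0, mul_zero]
  have hE2 : ∫ x, ∑ i, (Y x *ᵥ B.col i) ⬝ᵥ (Y x *ᵥ B.col i) ∂ν ≤ w * (NormedSpace.exp H).trace := by
    refine (integral_finsetSum _ fun i _ => hint2 _).trans_le ?_
    rw [hB, Matrix.trace_mul_comm, ← mul_one Bᵀ,
      trace_transpose_mul_mul, Finset.mul_sum]
    exact Finset.sum_le_sum fun i _ => by simpa using hw (B.col i)
  have hle : ∀ᵐ x ∂ν, (NormedSpace.exp (H + Y x)).trace ≤ (NormedSpace.exp H).trace +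
      (NormedSpace.exp H * Y x).trace + ∑ i, (Y x *ᵥ B.col i) ⬝ᵥ (Y x *ᵥ B.col i) := by
    filter_upwards [h1] with x hx using trace_exp_add_le_of_norm_le_one hH (hs x) hx hB
  have hI : Integrable (fun x => (NormedSpace.exp H).trace +
      (NormedSpace.exp H * Y x).trace + ∑ i, (Y x *ᵥ B.col i) ⬝ᵥ (Y x *ᵥ B.col i)) ν :=
    ((integrable_const _).add hI1).add hI2
  calc ∫⁻ x, ENNReal.ofReal (NormedSpace.exp (H + Y x)).trace ∂ν
      ≤ ∫⁻ x, ENNReal.ofReal ((NormedSpace.exp H).trace +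
        (NormedSpace.exp H * Y x).trace + ∑ i, (Y x *ᵥ B.col i) ⬝ᵥ (Y x *ᵥ B.col i)) ∂ν :=
        lintegral_mono_ae <| by
          filter_upwards [hle] with x hx using ENNReal.ofReal_le_ofReal hx
    _ = ENNReal.ofReal (∫ x, ((NormedSpace.exp H).trace +
        (NormedSpace.exp H * Y x).trace + ∑ i, (Y x *ᵥ B.col i) ⬝ᵥ (Y x *ᵥ B.col i)) ∂ν) := by
        refine (ofReal_integral_eq_lintegral_ofReal hI ?_).symm
        filter_upwards [hle] with x hx
        refine le_trans (trace_exp_nonneg ?_) hx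
        rw [Matrix.transpose_add, hH, hs]
    _ ≤ _ := by
        refine ENNReal.ofReal_le_ofReal ?_
        refine (integral_add ((integrable_const _).add hI1) hI2).trans_le ?_
        have := integral_add (integrable_const (NormedSpace.exp H).trace) hI1
        rw [hE1, integral_const, probReal_univ, one_smul] at this
        refine (add_le_add this.le hE2).trans_eq ?_
        ring

/-- Keep the first `n` entries of a sequence and replace the others by `e`. -/
def truncate {E : Type*} (e : E) (n : ℕ) (s : ℕ → E) : ℕ → E := fun i => if i < n then s i else e

theorem truncate_truncate {E : Type*} (e : E) {n n' : ℕ} (h : n ≤ n') (s : ℕ → E) :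
    truncate e n (truncate e n' s) = truncate e n s := by
  ext i
  unfold truncate
  split_ifs with h1 h2
  · rfl
  · omega
  · rfl

theorem measurable_truncate {E : Type*} [MeasurableSpace E] (e : E) (n : ℕ) : Measurable (truncate e n) := by
  refine measurable_pi_iff.2 fun i => ?_
  unfold truncate
  split_ifs <;> fun_prop

/-- Independence of coordinate n from the earlier ones plus Fubini. This plays the role of
conditioning on the past. -/
theorem lintegral_infinitePi_truncate (e : E) (n : ℕ) {F : (ℕ → E) → E → ENNReal}
    (hF : Measurable (Function.uncurry F)) :
    ∫⁻ s, F (truncate e n s) (s n) ∂(Measure.infinitePi fun _ => ν) =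
      ∫⁻ s, ∫⁻ x, F (truncate e n s) x ∂ν ∂(Measure.infinitePi fun _ => ν) := by
  set μ : Measure (ℕ → E) := Measure.infinitePi fun _ => ν
  have hind : IndepFun (truncate e n) (fun s : ℕ → E => s n) μ := by
    have h := (iIndepFun_infinitePi (P := fun _ : ℕ => ν) (X := fun _ x => x)
      (fun _ => measurable_id)).indepFun_finset (Finset.range n) {n} (by simp)
      (fun i => measurable_pi_apply i)
    have hφ : Measurable fun (v : Finset.range n → E) (i : ℕ) =>
        if hi : i ∈ Finset.range n then v ⟨i, hi⟩ else e :=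
      measurable_pi_iff.2 fun i => by split_ifs <;> fun_prop
    have hψ : Measurable fun v : ({n} : Finset ℕ) → E => v ⟨n, by simp⟩ := measurable_pi_apply _
    have h2 := h.comp hφ hψ
    convert h2 using 1
    · ext s i
      simp [truncate]
    · rfl
  have hmap : μ.map (fun s => (truncate e n s, s n)) = (μ.map (truncate e n)).prod ν := by
    rw [(indepFun_iff_map_prod_eq_prod_map_map (measurable_truncate e n).aemeasurable
      (measurable_pi_apply n).aemeasurable).1 hind, Measure.infinitePi_map_eval]
  calc ∫⁻ s, F (truncate e n s) (s n) ∂μ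
      = ∫⁻ q, Function.uncurry F q ∂(μ.map (fun s => (truncate e n s, s n))) :=
        (lintegral_map hF ((measurable_truncate e n).prodMk (measurable_pi_apply n))).symm
    _ = ∫⁻ s, ∫⁻ x, F s x ∂ν ∂(μ.map (truncate e n)) := by
        rw [hmap, lintegral_prod _ hF.aemeasurable]
        rfl
    _ = _ := lintegral_map hF.lintegral_prod_right' (measurable_truncate e n)

/-- Peel off the last summand with the earlier samples frozen. The summands may depend on the
samples before n₀ (hypothesis `ht`), and remain unchanged under truncation at any later index. The
dimension enters through tr exp 0. -/
theorem lintegral_trace_exp_sum_le {n : Type*} [Fintype n] [DecidableEq n] (e : E) (n₀ : ℕ)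
    {Y : (ℕ → E) → E → Matrix n n ℝ}
    (hm : ∀ i j, Measurable fun q : (ℕ → E) × E => Y q.1 q.2 i j)
    (ht : ∀ s, Y (truncate e n₀ s) = Y s) (hs : ∀ s x, (Y s x)ᵀ = Y s x)
    (h1 : ∀ s, ∀ᵐ x ∂ν, ‖Y s x‖ ≤ 1) (h0 : ∀ s i j, ∫ x, Y s x i j ∂ν = 0) {w : ℝ} (hw0 : 0 ≤ w)
    (hw : ∀ s u, ∫ x, (Y s x *ᵥ u) ⬝ᵥ (Y s x *ᵥ u) ∂ν ≤ w * (u ⬝ᵥ u)) (N : ℕ) :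
    ∫⁻ s, ENNReal.ofReal (NormedSpace.exp (∑ j ∈ Finset.Ico n₀ (n₀ + N), Y s (s j))).trace
        ∂(Measure.infinitePi fun _ => ν) ≤
      ENNReal.ofReal ((1 + w) ^ N * Fintype.card n) := by
  induction N with
  | zero => simp [Matrix.trace_one]
  | succ N ih =>
    have hY : ∀ s, Y (truncate e (n₀ + N) s) = Y s := fun s => by
      rw [← ht (truncate e (n₀ + N) s), truncate_truncate e (Nat.le_add_right _ _), ht]
    have hsum' : ∀ s, ∑ j ∈ Finset.Ico n₀ (n₀ + N), Y s (truncate e (n₀ + N) s j) =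
        ∑ j ∈ Finset.Ico n₀ (n₀ + N), Y s (s j) := fun s =>
      Finset.sum_congr rfl fun j hj => by simp [truncate, (Finset.mem_Ico.1 hj).2]
    have hF : Measurable (Function.uncurry fun (s : ℕ → E) x => ENNReal.ofReal
        (NormedSpace.exp (∑ j ∈ Finset.Ico n₀ (n₀ + N), Y s (s j) + Y s x)).trace) := by
      refine ENNReal.measurable_ofReal.comp (measurable_comp_of_entries continuous_trace_exp ?_)
      intro i j
      simp only [Matrix.add_apply, Matrix.sum_apply]
      refine Measurable.add (Finset.measurable_sum _ fun a _ => ?_) (hm i j)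
      exact (hm i j).comp (measurable_fst.prodMk ((measurable_pi_apply a).comp measurable_fst))
    have hkey := lintegral_infinitePi_truncate (ν := ν) e (n₀ + N) hF
    simp only [hsum', hY] at hkey
    calc ∫⁻ s, ENNReal.ofReal
          (NormedSpace.exp (∑ j ∈ Finset.Ico n₀ (n₀ + (N + 1)), Y s (s j))).trace
          ∂(Measure.infinitePi fun _ => ν)
        = ∫⁻ s, ENNReal.ofReal (NormedSpace.exp (∑ j ∈ Finset.Ico n₀ (n₀ + N), Y s (s j) +
          Y s (s (n₀ + N)))).trace ∂(Measure.infinitePi fun _ => ν) := by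
          simp only [← add_assoc, Finset.sum_Ico_succ_top (Nat.le_add_right n₀ N)]
      _ = _ := hkey
      _ ≤ ∫⁻ s, ENNReal.ofReal (1 + w) * ENNReal.ofReal
          (NormedSpace.exp (∑ j ∈ Finset.Ico n₀ (n₀ + N), Y s (s j))).trace
          ∂(Measure.infinitePi fun _ => ν) := by
          refine lintegral_mono fun s => ?_
          rw [← ENNReal.ofReal_mul (by positivity)]
          refine lintegral_trace_exp_add_le (fun i j => (hm i j).comp measurable_prodMk_left)
            (hs s) (h1 s) (h0 s) (hw s) ?_
          rw [Matrix.transpose_sum]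
          exact Finset.sum_congr rfl fun j _ => hs s (s j)
      _ = ENNReal.ofReal (1 + w) * ∫⁻ s, ENNReal.ofReal
          (NormedSpace.exp (∑ j ∈ Finset.Ico n₀ (n₀ + N), Y s (s j))).trace
          ∂(Measure.infinitePi fun _ => ν) := lintegral_const_mul' _ _ ENNReal.ofReal_ne_top
      _ ≤ ENNReal.ofReal (1 + w) * ENNReal.ofReal ((1 + w) ^ N * Fintype.card n) := by gcongr
      _ = _ := by rw [← ENNReal.ofReal_mul (by positivity), pow_succ']; ring_nf

end RandomMatrix

/-! ### Matrix Bernstein with factors that depend on the past. -/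

section Bernstein

theorem transpose_mul_mul_apply {d l r : Type*} [Fintype d] (A : Matrix d l ℝ) (X : Matrix d d ℝ) (R : Matrix d r ℝ)
    (i : l) (j : r) : (Aᵀ * X * R) i j = ∑ b, ∑ a, A a i * R b j * X a b := by
  simp only [Matrix.mul_apply, Matrix.transpose_apply, Finset.sum_mul]
  exact Finset.sum_congr rfl fun b _ => Finset.sum_congr rfl fun a _ => by ring

variable {E : Type*} [MeasurableSpace E] {ν : Measure E} [IsProbabilityMeasure ν]
  {d l r : Type*} [Fintype d] [Fintype l] [Fintype r] [DecidableEq d]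
  [DecidableEq l]
  [DecidableEq r]

theorem measurable_trace_exp_sum {E n : Type*} [MeasurableSpace E] [Fintype n] [DecidableEq n]
    {Y : (ℕ → E) → E → Matrix n n ℝ}
    (hm : ∀ i j, Measurable fun q : (ℕ → E) × E => Y q.1 q.2 i j) (I : Finset ℕ) :
    Measurable fun s : ℕ → E => (NormedSpace.exp (∑ j ∈ I, Y s (s j))).trace := by
  refine measurable_comp_of_entries continuous_trace_exp fun i j => ?_
  simp only [Matrix.sum_apply]
  refine Finset.measurable_sum _ fun a _ => ?_
  have h : Measurable fun s : ℕ → E => (s, s a) := measurable_id.prodMk (measurable_pi_apply a)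
  exact (hm i j).comp h

/-- Compressing by contractions does not increase the variance: the outer factor is dropped in each
block, and the inner one only moves the test vector. So the variance bound of X serves for the
dilation. -/
theorem dilation_dotProduct_self_le {A : Matrix d l ℝ} {X : Matrix d d ℝ} {R : Matrix d r ℝ}
    (hX : Xᵀ = X) (hA : ‖A‖ ≤ 1) (hR : ‖R‖ ≤ 1) (u : l ⊕ r → ℝ) :
    (dilation (Aᵀ * X * R) *ᵥ u) ⬝ᵥ (dilation (Aᵀ * X * R) *ᵥ u) ≤
      (X *ᵥ (R *ᵥ (u ∘ Sum.inr))) ⬝ᵥ (X *ᵥ (R *ᵥ (u ∘ Sum.inr))) +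
        (X *ᵥ (A *ᵥ (u ∘ Sum.inl))) ⬝ᵥ (X *ᵥ (A *ᵥ (u ∘ Sum.inl))) := by
  rw [dilation_mulVec, dotProduct_sum_elim, Matrix.transpose_mul, Matrix.transpose_mul,
    Matrix.transpose_transpose, hX, Matrix.mul_assoc]
  simp only [← Matrix.mulVec_mulVec]
  exact add_le_add
    (mulVec_dotProduct_self_le_of_norm_le_one (by rwa [norm_transpose]) _)
    (mulVec_dotProduct_self_le_of_norm_le_one (by rwa [norm_transpose]) _)

theorem norm_transpose_mul_mul_le {A : Matrix d l ℝ} {X : Matrix d d ℝ} {R : Matrix d r ℝ}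
    (hA : ‖A‖ ≤ 1) (hR : ‖R‖ ≤ 1) : ‖Aᵀ * X * R‖ ≤ ‖X‖ :=
  calc ‖Aᵀ * X * R‖ ≤ ‖Aᵀ‖ * ‖X‖ * ‖R‖ :=
        (Matrix.l2_opNorm_mul _ _).trans (by gcongr; exact Matrix.l2_opNorm_mul _ _)
    _ ≤ 1 * ‖X‖ * 1 := by rw [norm_transpose]; gcongr
    _ = ‖X‖ := by ring

/-- **Matrix Bernstein inequality** for `∑ⱼ Aᵀ X(sⱼ) R`, where the entries `sⱼ` of the sequence `s`
are independent and the bounded factors `A` and `R` depend only on the entries before those that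
are summed over. -/
theorem matrix_bernstein [Nonempty l] (e : E) (n₀ : ℕ) {X : E → Matrix d d ℝ}
    (hXm : ∀ i j, Measurable fun x => X x i j) (hXs : ∀ x, (X x)ᵀ = X x) {L w : ℝ} (hL : 0 < L)
    (hw0 : 0 < w) (hXL : ∀ᵐ x ∂ν, ‖X x‖ ≤ L) (hX0 : ∀ i j, ∫ x, X x i j ∂ν = 0)
    (hXw : ∀ u, ∫ x, (X x *ᵥ u) ⬝ᵥ (X x *ᵥ u) ∂ν ≤ w * (u ⬝ᵥ u))
    {A : (ℕ → E) → Matrix d l ℝ} {R : (ℕ → E) → Matrix d r ℝ}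
    (hAm : ∀ i j, Measurable fun s => A s i j) (hRm : ∀ i j, Measurable fun s => R s i j)
    (hA : ∀ s, ‖A s‖ ≤ 1) (hR : ∀ s, ‖R s‖ ≤ 1)
    (hAt : ∀ s, A (truncate e n₀ s) = A s) (hRt : ∀ s, R (truncate e n₀ s) = R s)
    {t : ℝ} (ht : 0 < t) (N : ℕ) :
    (Measure.infinitePi fun _ => ν) {s | N * t ≤
        ‖∑ j ∈ Finset.Ico n₀ (n₀ + N), (A s)ᵀ * X (s j) * R s‖} ≤
      ENNReal.ofReal ((Fintype.card l + Fintype.card r) *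
        Real.exp (-(N * min (t ^ 2 / (4 * w)) (t / (2 * L))))) := by
  -- θ is the smaller of t/(2w), which minimizes θ²w - θt, and 1/L, the largest scaling that keeps
  -- the summands of norm at most 1.
  obtain ⟨θ, hθ0, hθL, hθt⟩ : ∃ θ : ℝ, 0 < θ ∧ θ * L ≤ 1 ∧
      θ ^ 2 * w - θ * t ≤ -min (t ^ 2 / (4 * w)) (t / (2 * L)) := by
    rcases le_total (t / (2 * w)) (1 / L) with h | h
    · refine ⟨t / (2 * w), by positivity, (le_div_iff₀ hL).1 h, ?_⟩
      have h1 := min_le_left (t ^ 2 / (4 * w)) (t / (2 * L))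
      have h2 : (t / (2 * w)) ^ 2 * w - t / (2 * w) * t = -(t ^ 2 / (4 * w)) := by
        field_simp; ring
      linarith
    · refine ⟨1 / L, by positivity, by rw [one_div_mul_cancel hL.ne'], ?_⟩
      have h1 := min_le_right (t ^ 2 / (4 * w)) (t / (2 * L))
      have h2 : 1 / L * w ≤ t / 2 := by
        calc 1 / L * w ≤ t / (2 * w) * w := by gcongr
          _ = t / 2 := by field_simp
      have h3 : (1 / L) ^ 2 * w ≤ 1 / L * (t / 2) := by
        rw [pow_two, mul_assoc]; gcongr
      have h4 : 1 / L * (t / 2) - 1 / L * t = -(t / (2 * L)) := by field_simp; ring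
      linarith
  set Y : (ℕ → E) → E → Matrix (l ⊕ r) (l ⊕ r) ℝ :=
    fun s x => θ • dilation ((A s)ᵀ * X x * R s) with hYdef
  have hent : ∀ (s : ℕ → E) i j, ∫ x, ((A s)ᵀ * X x * R s) i j ∂ν = 0 := fun s i j => by
    have hI := integrable_apply_of_norm_le hXm hXL
    simp only [transpose_mul_mul_apply]
    refine (integral_finsetSum _ fun b _ => integrable_finsetSum _ fun a _ =>
      (hI a b).const_mul _).trans (Finset.sum_eq_zero fun b _ => ?_)
    refine (integral_finsetSum _ fun a _ => (hI a b).const_mul _).trans ?_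
    exact Finset.sum_eq_zero fun a _ => by rw [integral_const_mul, hX0, mul_zero]
  have hentm : ∀ i j, Measurable fun q : (ℕ → E) × E => ((A q.1)ᵀ * X q.2 * R q.1) i j := by
    intro i j
    simp only [transpose_mul_mul_apply]
    exact Finset.measurable_sum _ fun b _ => Finset.measurable_sum _ fun a _ =>
      (((hAm a i).comp measurable_fst).mul ((hRm b j).comp measurable_fst)).mul
        ((hXm a b).comp measurable_snd)
  have hYm : ∀ i j, Measurable fun q : (ℕ → E) × E => Y q.1 q.2 i j := by
    rintro (i | i) (j | j)
    · simp [hYdef, dilation]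
    · simpa [hYdef, dilation] using (hentm i j).const_mul θ
    · simpa [hYdef, dilation, -Matrix.transpose_mul] using (hentm j i).const_mul θ
    · simp [hYdef, dilation]
  have hmgf := lintegral_trace_exp_sum_le (ν := ν) e n₀ (Y := Y) (w := θ ^ 2 * w) hYm ?_ ?_ ?_ ?_
    (by positivity) ?_ N
  rotate_left
  · intro s
    simp only [hYdef, hAt, hRt]
  · intro s x
    simp only [hYdef, Matrix.transpose_smul, transpose_dilation]
  · intro s
    filter_upwards [hXL] with x hx
    rw [norm_smul, Real.norm_of_nonneg hθ0.le]
    refine le_trans ?_ hθL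
    gcongr
    exact (norm_dilation_le _).trans ((norm_transpose_mul_mul_le (hA s) (hR s)).trans hx)
  · rintro s (i | i) (j | j)
    · simp [hYdef, dilation]
    · simp only [hYdef, dilation, Matrix.smul_apply, Matrix.fromBlocks_apply₁₂, smul_eq_mul]
      rw [integral_const_mul, hent, mul_zero]
    · simp only [hYdef, dilation, Matrix.smul_apply, Matrix.fromBlocks_apply₂₁, smul_eq_mul]
      rw [integral_const_mul]
      exact mul_eq_zero_of_right _ (hent s j i)
    · simp [hYdef, dilation]
  · intro s u
    have hI := integrable_mulVec_dotProduct_self hXm hXL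
    have h1 := hXw (R s *ᵥ (u ∘ Sum.inr))
    have h2 := hXw (A s *ᵥ (u ∘ Sum.inl))
    have h3 := mulVec_dotProduct_self_le_of_norm_le_one (hR s) (u ∘ Sum.inr)
    have h4 := mulVec_dotProduct_self_le_of_norm_le_one (hA s) (u ∘ Sum.inl)
    have h5 : ∀ x, (Y s x *ᵥ u) ⬝ᵥ (Y s x *ᵥ u) ≤ θ ^ 2 *
        ((X x *ᵥ (R s *ᵥ (u ∘ Sum.inr))) ⬝ᵥ (X x *ᵥ (R s *ᵥ (u ∘ Sum.inr))) +
        (X x *ᵥ (A s *ᵥ (u ∘ Sum.inl))) ⬝ᵥ (X x *ᵥ (A s *ᵥ (u ∘ Sum.inl)))) := fun x => by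
      simp only [hYdef, Matrix.smul_mulVec, smul_dotProduct, dotProduct_smul, smul_eq_mul]
      rw [← mul_assoc, ← pow_two]
      exact mul_le_mul_of_nonneg_left (dilation_dotProduct_self_le (hXs x) (hA s) (hR s) u)
        (sq_nonneg θ)
    calc ∫ x, (Y s x *ᵥ u) ⬝ᵥ (Y s x *ᵥ u) ∂ν
        ≤ ∫ x, θ ^ 2 *
          ((X x *ᵥ (R s *ᵥ (u ∘ Sum.inr))) ⬝ᵥ (X x *ᵥ (R s *ᵥ (u ∘ Sum.inr))) +
          (X x *ᵥ (A s *ᵥ (u ∘ Sum.inl))) ⬝ᵥ (X x *ᵥ (A s *ᵥ (u ∘ Sum.inl)))) ∂ν := by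
          refine integral_mono_of_nonneg (Filter.Eventually.of_forall fun x => ?_)
            (((hI _).add (hI _)).const_mul _) (Filter.Eventually.of_forall h5)
          simp only [Pi.zero_apply]
          rw [dotProduct_self_eq_norm_sq]; positivity
      _ ≤ θ ^ 2 * (w * (u ⬝ᵥ u)) := by
          rw [integral_const_mul]
          refine mul_le_mul_of_nonneg_left ?_ (sq_nonneg θ)
          refine (integral_add (hI _) (hI _)).trans_le ((add_le_add h1 h2).trans ?_)
          rw [dotProduct_self_sum, ← mul_add]
          refine mul_le_mul_of_nonneg_left ?_ hw0.le
          linarith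
      _ = θ ^ 2 * w * (u ⬝ᵥ u) := by ring
  have hsumY : ∀ s, ∑ j ∈ Finset.Ico n₀ (n₀ + N), Y s (s j) =
      dilation (θ • ∑ j ∈ Finset.Ico n₀ (n₀ + N), (A s)ᵀ * X (s j) * R s) := fun s => by
    simp only [hYdef]
    rw [dilation_smul, ← Finset.smul_sum]
    congr 1
    induction Finset.Ico n₀ (n₀ + N) using Finset.cons_induction with
    | empty => simp [dilation_zero]
    | cons a S ha ih => rw [Finset.sum_cons, Finset.sum_cons, dilation_add, ih]
  set c := Real.exp (θ * (N * t)) with hc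
  have hc0 : 0 < c := Real.exp_pos _
  have hmeas : Measurable fun s : ℕ → E => ENNReal.ofReal
      (NormedSpace.exp (∑ j ∈ Finset.Ico n₀ (n₀ + N), Y s (s j))).trace :=
    ENNReal.measurable_ofReal.comp (measurable_trace_exp_sum hYm _)
  -- Chernoff: Markov's inequality for the trace exponential, then (1 + θ²w)^N ≤ exp(Nθ²w).
  calc (Measure.infinitePi fun _ => ν) {s | N * t ≤
        ‖∑ j ∈ Finset.Ico n₀ (n₀ + N), (A s)ᵀ * X (s j) * R s‖}
      ≤ (Measure.infinitePi fun _ => ν) {s | ENNReal.ofReal c ≤ ENNReal.ofReal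
        (NormedSpace.exp (∑ j ∈ Finset.Ico n₀ (n₀ + N), Y s (s j))).trace} := by
        refine measure_mono fun s hs => ?_
        refine ENNReal.ofReal_le_ofReal ?_
        rw [hsumY]
        refine le_trans (Real.exp_le_exp.2 ?_) (exp_norm_le_trace_exp_dilation _)
        rw [norm_smul, Real.norm_of_nonneg hθ0.le]
        exact mul_le_mul_of_nonneg_left hs hθ0.le
    _ ≤ (∫⁻ s, ENNReal.ofReal (NormedSpace.exp (∑ j ∈ Finset.Ico n₀ (n₀ + N), Y s (s j))).trace
        ∂(Measure.infinitePi fun _ => ν)) / ENNReal.ofReal c :=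
        meas_ge_le_lintegral_div hmeas.aemeasurable (by simpa using hc0) ENNReal.ofReal_ne_top
    _ ≤ ENNReal.ofReal ((1 + θ ^ 2 * w) ^ N * Fintype.card (l ⊕ r)) / ENNReal.ofReal c := by
        gcongr
    _ = ENNReal.ofReal ((1 + θ ^ 2 * w) ^ N * Fintype.card (l ⊕ r) / c) :=
        (ENNReal.ofReal_div_of_pos hc0).symm
    _ ≤ _ := by
        refine ENNReal.ofReal_le_ofReal ?_
        rw [Fintype.card_sum, div_eq_mul_inv, hc, ← Real.exp_neg, Nat.cast_add, mul_right_comm,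
          mul_comm]
        refine mul_le_mul_of_nonneg_left ?_ (by positivity)
        calc (1 + θ ^ 2 * w) ^ N * Real.exp (-(θ * (N * t)))
            ≤ Real.exp (θ ^ 2 * w) ^ N * Real.exp (-(θ * (N * t))) := by
              gcongr
              rw [add_comm]
              exact Real.add_one_le_exp _
          _ = Real.exp (N * (θ ^ 2 * w - θ * t)) := by
              rw [← Real.exp_nat_mul, ← Real.exp_add]; congr 1; ring
          _ ≤ _ := by
              rw [Real.exp_le_exp, ← mul_neg]
              exact mul_le_mul_of_nonneg_left hθt (Nat.cast_nonneg N)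

end Bernstein

/-! ### Projections, the basis completed by `adjoin`, and singular values. -/

section Projections

variable {d r k m : ℕ}

theorem dotProduct_mulVec_self (A : Mat d r) (x : Fin r → ℝ) :
    (A *ᵥ x) ⬝ᵥ (A *ᵥ x) = x ⬝ᵥ ((Aᵀ * A) *ᵥ x) := by
  rw [← Matrix.mulVec_mulVec, Matrix.dotProduct_mulVec x, Matrix.vecMul_transpose]

theorem norm_le_one_of_transpose_mul_self {Q : Mat d r} (hQ : Qᵀ * Q = 1) : ‖Q‖ ≤ 1 :=
  norm_le_of_mulVec_dotProduct_self_le zero_le_one fun x => by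
    rw [dotProduct_mulVec_self, hQ, Matrix.one_mulVec]; simp

theorem dotProduct_mulVec_le_norm_mul (A : Mat d d) (u : Fin d → ℝ) :
    u ⬝ᵥ (A *ᵥ u) ≤ ‖A‖ * (u ⬝ᵥ u) := by
  have h1 := real_inner_le_norm (WithLp.toLp 2 (A *ᵥ u)) (WithLp.toLp 2 u)
  have h2 := Matrix.l2_opNorm_mulVec A (WithLp.toLp 2 u)
  rw [EuclideanSpace.inner_toLp_toLp, star_trivial] at h1
  rw [dotProduct_self_eq_norm_sq]
  calc _ ≤ _ := h1
    _ ≤ ‖A‖ * ‖WithLp.toLp 2 u‖ * ‖WithLp.toLp 2 u‖ := by gcongr; exact h2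
    _ = _ := by ring

theorem transpose_projPerp (U : Mat d r) : (projPerp U)ᵀ = projPerp U := by
  simp [projPerp, proj]

theorem norm_projPerp_le_one {U : Mat d r} (hU : Uᵀ * U = 1) : ‖projPerp U‖ ≤ 1 := by
  have h : (projPerp U)ᵀ * projPerp U = 1 - U * Uᵀ := by
    have : U * Uᵀ * (U * Uᵀ) = U * Uᵀ := by
      rw [Matrix.mul_assoc, ← Matrix.mul_assoc Uᵀ, hU, Matrix.one_mul]
    rw [transpose_projPerp, projPerp, proj, mul_sub, sub_mul, sub_mul, this]
    simp
  refine norm_le_of_mulVec_dotProduct_self_le zero_le_one fun x => ?_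
  have h2 := dotProduct_mulVec_self Uᵀ x
  rw [Matrix.transpose_transpose] at h2
  rw [dotProduct_mulVec_self, h, Matrix.sub_mulVec, Matrix.one_mulVec, dotProduct_sub, ← h2,
    dotProduct_self_eq_norm_sq (Uᵀ *ᵥ x)]
  nlinarith [sq_nonneg ‖WithLp.toLp 2 (Uᵀ *ᵥ x)‖]

theorem transpose_mulVec_orthResidual {W : Mat d m} (hW : Wᵀ * W = 1) (f : Vec d) :
    Wᵀ *ᵥ (orthResidual W f).ofLp = 0 := by
  have : (orthResidual W f).ofLp = projPerp W *ᵥ f.ofLp := by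
    simp [orthResidual, Matrix.toLpLin_apply]
  rw [this, Matrix.mulVec_mulVec, projPerp, proj, Matrix.mul_sub,
    ← Matrix.mul_assoc, hW]
  simp

theorem transpose_mul_adjoin {W : Mat d m} (hW : Wᵀ * W = 1) (f : Vec d) :
    (adjoin W f).2ᵀ * (adjoin W f).2 = 1 := by
  by_cases h : orthResidual W f = 0
  · rw [show adjoin W f = ⟨m, W⟩ from if_pos h]
    exact hW
  · rw [show adjoin W f = ⟨m + 1, Matrix.of fun i =>
      Fin.snoc (fun j => W i j) (orthResidual W f i / ‖orthResidual W f‖)⟩ from if_neg h]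
    have h0 : ‖orthResidual W f‖ ≠ 0 := norm_ne_zero_iff.2 h
    have h1 := transpose_mulVec_orthResidual hW f
    have h2 := dotProduct_self_eq_norm_sq (orthResidual W f).ofLp
    set g := orthResidual W f
    have h3 : ∀ j, ∑ x, W x j * g x = 0 := fun j => congrFun h1 j
    ext i j
    rw [Matrix.mul_apply]
    simp only [Matrix.transpose_apply, Matrix.of_apply]
    refine Fin.lastCases ?_ (fun i => ?_) i <;> refine Fin.lastCases ?_ (fun j => ?_) j
    · simp only [Fin.snoc_last, Matrix.one_apply_eq]
      have h4 : ∑ x, g x * g x = ‖g‖ ^ 2 := h2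
      calc ∑ x, g x / ‖g‖ * (g x / ‖g‖) = (∑ x, g x * g x) / ‖g‖ ^ 2 := by
            rw [Finset.sum_div]; exact Finset.sum_congr rfl fun x _ => by ring
        _ = 1 := by rw [h4, div_self (pow_ne_zero 2 h0)]
    · simp only [Fin.snoc_last, Fin.snoc_castSucc]
      rw [Matrix.one_apply_ne (Fin.castSucc_lt_last j).ne']
      calc ∑ x, g x / ‖g‖ * W x j = (∑ x, W x j * g x) / ‖g‖ := by
            rw [Finset.sum_div]; exact Finset.sum_congr rfl fun x _ => by ring
        _ = 0 := by rw [h3, zero_div]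
    · simp only [Fin.snoc_last, Fin.snoc_castSucc]
      rw [Matrix.one_apply_ne (Fin.castSucc_lt_last i).ne]
      calc ∑ x, W x i * (g x / ‖g‖) = (∑ x, W x i * g x) / ‖g‖ := by
            rw [Finset.sum_div]; exact Finset.sum_congr rfl fun x _ => by ring
        _ = 0 := by rw [h3, zero_div]
    · simp only [Fin.snoc_castSucc]
      have := congrFun (congrFun hW i) j
      rw [Matrix.mul_apply] at this
      simpa [Matrix.one_apply] using this

theorem norm_mul_le_of_le_one_left {a b c : ℕ} {A : Mat a b} (hA : ‖A‖ ≤ 1) (B : Mat b c) :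
    ‖A * B‖ ≤ ‖B‖ :=
  (Matrix.l2_opNorm_mul A B).trans (mul_le_of_le_one_left (norm_nonneg _) hA)

theorem norm_mul_le_of_le_one_right {a b c : ℕ} (A : Mat a b) {B : Mat b c} (hB : ‖B‖ ≤ 1) :
    ‖A * B‖ ≤ ‖A‖ :=
  (Matrix.l2_opNorm_mul A B).trans (mul_le_of_le_one_right (norm_nonneg _) hB)

/-- Change one projection at a time. This is the bias caused by using Û in place of U. -/
theorem norm_conj_sub_conj_le {P P' : Mat d d} (hP : ‖P‖ ≤ 1) (hP' : ‖P'‖ ≤ 1) (S : Mat d d) :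
    ‖P' * S * P' - P * S * P‖ ≤ 2 * ‖S‖ * ‖P' - P‖ := by
  have h : P' * S * P' - P * S * P = (P' - P) * S * P' + P * S * (P' - P) := by noncomm_ring
  rw [h]
  calc _ ≤ ‖(P' - P) * S * P'‖ + ‖P * S * (P' - P)‖ := norm_add_le _ _
    _ ≤ ‖P' - P‖ * ‖S‖ + ‖S‖ * ‖P' - P‖ := by
        refine add_le_add ?_ ?_
        · exact (norm_mul_le_of_le_one_right _ hP').trans (Matrix.l2_opNorm_mul _ _)
        · rw [mul_assoc]
          exact (norm_mul_le_of_le_one_left hP _).trans (Matrix.l2_opNorm_mul _ _)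
    _ = _ := by ring

/-- A column of Q is a unit eigenvector that A stretches by exactly this singular value. -/
theorem singVal_le_norm {A : Mat d d} {Q : Mat d k} (hQ : IsTopEigenvectors A Q) {i : ℕ}
    (hi : 1 ≤ i) (hik : i ≤ k) : singVal A i ≤ ‖A‖ := by
  obtain ⟨hQ1, lam, hAQ, hlam⟩ := hQ
  have h := hlam ⟨i - 1, by omega⟩
  rw [show (((⟨i - 1, by omega⟩ : Fin k) : ℕ) + 1) = i by simp; omega] at h
  rw [← h]
  set j : Fin k := ⟨i - 1, by omega⟩
  set q : Fin d → ℝ := Q *ᵥ Pi.single j 1 with hq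
  have hqq : q ⬝ᵥ q = 1 := by
    rw [hq, dotProduct_mulVec_self, hQ1, Matrix.one_mulVec]; simp
  have hAq : A *ᵥ q = lam j • q := by
    rw [hq, Matrix.mulVec_mulVec, hAQ, ← Matrix.mulVec_mulVec, ← Matrix.mulVec_smul]
    congr 1
    ext a
    simp only [Matrix.mulVec_diagonal, Pi.single_apply, Pi.smul_apply, smul_eq_mul]
    split_ifs with h
    · rw [h]
    · simp
  have h2 := mulVec_dotProduct_self_le A q
  rw [hAq, smul_dotProduct, dotProduct_smul, hqq] at h2
  simp only [smul_eq_mul, mul_one] at h2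
  refine abs_le_of_sq_le_sq ?_ (norm_nonneg _)
  linarith [pow_two (lam j)]

theorem singVal_nonneg (A : Mat d d) (i : ℕ) : 0 ≤ singVal A i :=
  LinearMap.singularValues_nonneg _ _

end Projections

/-! ### Moments, boundedness and variance of the data distribution. -/

section Data

variable {d m : ℕ}

theorem measurable_outer_apply (i j : Fin d) : Measurable fun x : Vec d => outer x i j := by
  simp only [outer, Matrix.of_apply]
  fun_prop

theorem transpose_outer (x : Vec d) : (outer x)ᵀ = outer x := by
  ext i j
  simp [outer, mul_comm]

theorem transpose_covMatrix (μ : Measure (Vec d)) : (covMatrix μ)ᵀ = covMatrix μ := by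
  ext i j
  simp only [covMatrix, Matrix.transpose_apply, Matrix.of_apply]
  exact covariance_comm _ _

theorem memLp_apply_of_norm_outer_le {μ : Measure (Vec d)} [IsProbabilityMeasure μ] {K : ℝ}
    (hK : ∀ᵐ x ∂μ, ‖outer x‖ ≤ K) (i : Fin d) : MemLp (fun x : Vec d => x i) 2 μ := by
  refine MemLp.of_bound (by fun_prop) √K ?_
  filter_upwards [hK] with x hx
  refine Real.abs_le_sqrt ((le_trans (le_abs_self _) ?_).trans hx)
  rw [pow_two]
  exact abs_apply_le_norm (outer x) i i

/-- Boundedness makes the coordinates square integrable, so that the integrals in mean and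
covariance have no default values. -/
theorem covMatrix_add_outer_mean {μ : Measure (Vec d)} [IsProbabilityMeasure μ] {K : ℝ}
    (hK : ∀ᵐ x ∂μ, ‖outer x‖ ≤ K) : covMatrix μ + outer (mean μ) = expMat μ outer := by
  have hL := memLp_apply_of_norm_outer_le hK
  have hint : Integrable (fun x : Vec d => x) μ := by
    exact (MemLp.of_eval_piLp hL).integrable one_le_two
  have hmean : ∀ i, mean μ i = ∫ x : Vec d, x i ∂μ := fun i =>
    ((EuclideanSpace.proj (𝕜 := ℝ) i).integral_comp_comm hint).symm
  ext i j
  simp only [covMatrix, outer, expMat, Matrix.add_apply, Matrix.of_apply, hmean]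
  rw [covariance_eq_sub (hL i) (hL j)]
  simp

theorem integral_mixture {D : Bool → Measure (Vec d)} {p : Set.Ioo (0 : ℝ) 1} {h : Vec d → ℝ}
    (h1 : ∀ a, Integrable h (D a)) :
    ∫ x, h x ∂(mixture D p) = p * ∫ x, h x ∂(D true) + (1 - p) * ∫ x, h x ∂(D false) := by
  have h0 : (0 : ℝ) ≤ p := p.2.1.le
  have h0' : (0 : ℝ) ≤ 1 - p := sub_nonneg.2 p.2.2.le
  rw [mixture, integral_add_measure ((h1 _).smul_measure ENNReal.ofReal_ne_top)
    ((h1 _).smul_measure ENNReal.ofReal_ne_top), integral_smul_measure, integral_smul_measure,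
    ENNReal.toReal_ofReal h0, ENNReal.toReal_ofReal h0', smul_eq_mul, smul_eq_mul]

theorem ae_mixture {D : Bool → Measure (Vec d)} {p : Set.Ioo (0 : ℝ) 1} {P : Vec d → Prop}
    (h : ∀ a, ∀ᵐ x ∂(D a), P x) : ∀ᵐ x ∂(mixture D p), P x :=
  ae_add_measure_iff.2 ⟨Measure.ae_smul_measure (h true) _, Measure.ae_smul_measure (h false) _⟩

theorem map_snd_sampleLaw (D : Bool → Measure (Vec d)) [∀ a, IsProbabilityMeasure (D a)]
    (p : Set.Ioo (0 : ℝ) 1) : (sampleLaw D p).map Prod.snd = mixture D p := by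
  rw [sampleLaw, mixture, Measure.map_add _ _ measurable_snd, Measure.map_smul, Measure.map_smul,
    Measure.map_snd_prod, Measure.map_snd_prod]
  simp

instance isProbabilityMeasure_mixture (D : Bool → Measure (Vec d))
    [∀ a, IsProbabilityMeasure (D a)] (p : Set.Ioo (0 : ℝ) 1) :
    IsProbabilityMeasure (mixture D p) := by
  rw [← map_snd_sampleLaw]
  exact Measure.isProbabilityMeasure_map measurable_snd.aemeasurable

/-- The centered second moment matrix of a sample. -/
noncomputable def centeredOuter (D : Bool → Measure (Vec d)) (p : Set.Ioo (0 : ℝ) 1)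
    (s : Sample d) : Mat d d := outer s.2 - covMatrix (mixture D p)

theorem measurable_centeredOuter_apply {D : Bool → Measure (Vec d)} {p : Set.Ioo (0 : ℝ) 1}
    (i j : Fin d) :
    Measurable fun s : Sample d => centeredOuter D p s i j := by
  simp only [centeredOuter, Matrix.sub_apply]
  exact ((measurable_outer_apply i j).comp measurable_snd).sub_const _

theorem transpose_centeredOuter {D : Bool → Measure (Vec d)} {p : Set.Ioo (0 : ℝ) 1}
    (s : Sample d) :
    (centeredOuter D p s)ᵀ = centeredOuter D p s := by
  rw [centeredOuter, Matrix.transpose_sub, transpose_outer, transpose_covMatrix]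

theorem DataAssumption.norm_outer_le {D : Bool → Measure (Vec d)} {p : Set.Ioo (0 : ℝ) 1}
    {P : Mat d m} {C : DataConstants} (h : DataAssumption C D p P) (a : Bool) :
    ∀ᵐ x ∂(D a), ‖outer x‖ ≤ C.M + C.V := by
  filter_upwards [h.bounded a] with x hx
  calc ‖outer x‖ = ‖(outer x - secondMoment (D a)) + secondMoment (D a)‖ := by
        rw [sub_add_cancel]
    _ ≤ _ := (norm_add_le _ _).trans (add_le_add hx (h.moment_le a))

variable {D : Bool → Measure (Vec d)} [∀ a, IsProbabilityMeasure (D a)] {p : Set.Ioo (0 : ℝ) 1}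
  {P : Mat d m} {C : DataConstants}

/-- For a centered law the covariance is the second moment, which is linear in the law. -/
theorem DataAssumption.covMatrix_mixture_eq (h : DataAssumption C D p P)
    (h0 : mean (mixture D p) = 0) : covMatrix (mixture D p) =
      (p : ℝ) • secondMoment (D true) + (1 - (p : ℝ)) • secondMoment (D false) := by
  have h1 := covMatrix_add_outer_mean (ae_mixture (p := p) h.norm_outer_le)
  have h2 : outer (0 : Vec d) = 0 := by ext i j; simp [outer]
  rw [h0, h2, add_zero] at h1
  have h3 : ∀ a, secondMoment (D a) = expMat (D a) outer := fun a =>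
    covMatrix_add_outer_mean (h.norm_outer_le a)
  rw [h1, h3, h3]
  ext i j
  simp only [expMat, Matrix.add_apply, Matrix.smul_apply, Matrix.of_apply, smul_eq_mul]
  exact integral_mixture fun a =>
    integrable_apply_of_norm_le measurable_outer_apply (h.norm_outer_le a) i j

theorem DataAssumption.norm_covMatrix_mixture_le (h : DataAssumption C D p P)
    (h0 : mean (mixture D p) = 0) : ‖covMatrix (mixture D p)‖ ≤ C.V := by
  have hp : (0 : ℝ) ≤ p := p.2.1.le
  have hp' : (0 : ℝ) ≤ 1 - p := sub_nonneg.2 p.2.2.le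
  rw [h.covMatrix_mixture_eq h0]
  refine (norm_add_le _ _).trans ?_
  rw [norm_smul, norm_smul, Real.norm_of_nonneg hp, Real.norm_of_nonneg hp']
  nlinarith [h.moment_le true, h.moment_le false]

/-- The left side is the quadratic form of E[YᵀY], the second matrix in the maximum defining
`matVar`. -/
theorem integral_centered_mulVec_dotProduct_self_le {μ : Measure (Vec d)} [IsProbabilityMeasure μ]
    {K : ℝ} (hK : ∀ᵐ x ∂μ, ‖outer x‖ ≤ K) (u : Fin d → ℝ) :
    ∫ x, ((outer x - secondMoment μ) *ᵥ u) ⬝ᵥ ((outer x - secondMoment μ) *ᵥ u) ∂μ ≤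
      matVar μ outer * (u ⬝ᵥ u) := by
  have hS : secondMoment μ = expMat μ outer := covMatrix_add_outer_mean hK
  have hm : ∀ i j, Measurable fun x : Vec d => (outer x - secondMoment μ) i j := fun i j => by
    simp only [Matrix.sub_apply]
    exact (measurable_outer_apply i j).sub_const _
  have hb : ∀ᵐ x ∂μ, ‖outer x - secondMoment μ‖ ≤ K + ‖secondMoment μ‖ := by
    filter_upwards [hK] with x hx using (norm_sub_le _ _).trans (by gcongr)
  set Y : Vec d → Mat d d := fun x => outer x - secondMoment μ with hY
  have hm2 : ∀ i j, Measurable fun x => ((Y x)ᵀ * Y x) i j := fun i j => by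
    simp only [Matrix.mul_apply, Matrix.transpose_apply]
    exact Finset.measurable_sum _ fun a _ => (hm a i).mul (hm a j)
  have hI : ∀ i j, Integrable (fun x => ((Y x)ᵀ * Y x) i j) μ := by
    refine integrable_apply_of_norm_le hm2 (L := (K + ‖secondMoment μ‖) * (K + ‖secondMoment μ‖)) ?_
    filter_upwards [hb] with x hx
    refine (Matrix.l2_opNorm_mul _ _).trans ?_
    rw [norm_transpose]
    exact mul_le_mul hx hx (norm_nonneg _) ((norm_nonneg _).trans hx)
  have hquad : ∫ x, (Y x *ᵥ u) ⬝ᵥ (Y x *ᵥ u) ∂μ =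
      u ⬝ᵥ ((expMat μ fun x => (Y x)ᵀ * Y x) *ᵥ u) := by
    simp only [dotProduct_mulVec_self]
    simp only [dotProduct, Matrix.mulVec, Finset.mul_sum]
    refine (integral_finsetSum _ fun i _ => integrable_finsetSum _ fun j _ =>
      ((hI i j).mul_const _).const_mul _).trans (Finset.sum_congr rfl fun i _ => ?_)
    refine (integral_finsetSum _ fun j _ => ((hI i j).mul_const _).const_mul _).trans
      (Finset.sum_congr rfl fun j _ => ?_)
    rw [integral_const_mul, integral_mul_const]
    rfl
  have hle : ‖expMat μ fun x => (Y x)ᵀ * Y x‖ ≤ matVar μ outer := by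
    rw [hY, hS]
    exact le_max_right _ _
  refine hquad.trans_le (le_trans ?_ (mul_le_mul_of_nonneg_right hle ?_))
  · exact dotProduct_mulVec_le_norm_mul _ u
  · rw [dotProduct_self_eq_norm_sq]; positivity

theorem DataAssumption.norm_sub_covMatrix_le (h : DataAssumption C D p P)
    (h0 : mean (mixture D p) = 0) (a : Bool) :
    ‖secondMoment (D a) - covMatrix (mixture D p)‖ ≤ 2 * C.V :=
  (norm_sub_le _ _).trans (by linarith [h.moment_le a, h.norm_covMatrix_mixture_le h0])

theorem DataAssumption.norm_centeredOuter_le (h : DataAssumption C D p P)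
    (h0 : mean (mixture D p) = 0) :
    ∀ᵐ s ∂(sampleLaw D p), ‖centeredOuter D p s‖ ≤ C.M + 2 * C.V := by
  have : ∀ᵐ x ∂(mixture D p), ‖outer x - covMatrix (mixture D p)‖ ≤ C.M + 2 * C.V :=
    ae_mixture fun a => by
      filter_upwards [h.bounded a] with x hx
      rw [← sub_add_sub_cancel _ (secondMoment (D a))]
      exact (norm_add_le _ _).trans (add_le_add hx (h.norm_sub_covMatrix_le h0 a))
  rw [← map_snd_sampleLaw] at this
  have h2 := ae_of_ae_map measurable_snd.aemeasurable this
  rw [map_snd_sampleLaw] at h2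
  exact h2

theorem integral_sampleLaw {h : Vec d → ℝ} (hh : Measurable h) :
    ∫ s, h s.2 ∂(sampleLaw D p) = ∫ x, h x ∂(mixture D p) := by
  rw [← map_snd_sampleLaw, integral_map measurable_snd.aemeasurable hh.aestronglyMeasurable]

theorem DataAssumption.integral_centeredOuter (h : DataAssumption C D p P)
    (h0 : mean (mixture D p) = 0) (i j : Fin d) :
    ∫ s, centeredOuter D p s i j ∂(sampleLaw D p) = 0 := by
  have h1 := covMatrix_add_outer_mean (ae_mixture (p := p) h.norm_outer_le)
  have h2 : outer (0 : Vec d) = 0 := by ext i j; simp [outer]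
  rw [h0, h2, add_zero] at h1
  have hI := integrable_apply_of_norm_le measurable_outer_apply
    (ae_mixture (p := p) h.norm_outer_le) i j
  simp only [centeredOuter, Matrix.sub_apply]
  rw [integral_sampleLaw (h := fun x => outer x i j - covMatrix (mixture D p) i j)
    ((measurable_outer_apply i j).sub_const _), integral_sub hI (integrable_const _), h1]
  simp [expMat]

/-- Within group a, center at the group second moment: the fluctuation contributes 2·Var and the
shift to Σ, of norm at most 2V, contributes 2(2V)². The sum is at most 8(Var + V²), and averaging
over the groups preserves it. -/
theorem DataAssumption.integral_centeredOuter_sq_le (h : DataAssumption C D p P)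
    (h0 : mean (mixture D p) = 0) (u : Fin d → ℝ) :
    ∫ s, (centeredOuter D p s *ᵥ u) ⬝ᵥ (centeredOuter D p s *ᵥ u) ∂(sampleLaw D p) ≤
      8 * (C.Var + C.V ^ 2) * (u ⬝ᵥ u) := by
  have hp : (0 : ℝ) ≤ p := p.2.1.le
  have hp' : (0 : ℝ) ≤ 1 - p := sub_nonneg.2 p.2.2.le
  have hu : 0 ≤ u ⬝ᵥ u := by rw [dotProduct_self_eq_norm_sq]; positivity
  have hc : Continuous fun M : Mat d d => (M *ᵥ u) ⬝ᵥ (M *ᵥ u) := by fun_prop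
  have hm : ∀ S : Mat d d, ∀ i j, Measurable fun x : Vec d => (outer x - S) i j := fun S i j => by
    simp only [Matrix.sub_apply]
    exact (measurable_outer_apply i j).sub_const _
  have hb : ∀ (S : Mat d d) (a : Bool), ∀ᵐ x ∂(D a), ‖outer x - S‖ ≤ C.M + C.V + ‖S‖ :=
    fun S a => by
      filter_upwards [h.norm_outer_le a] with x hx using (norm_sub_le _ _).trans (by gcongr)
  have hI := fun S a => integrable_mulVec_dotProduct_self (hm S) (hb S a) u
  set S := covMatrix (mixture D p) with hS
  have hgroup : ∀ a, ∫ x, ((outer x - S) *ᵥ u) ⬝ᵥ ((outer x - S) *ᵥ u) ∂(D a) ≤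
      8 * (C.Var + C.V ^ 2) * (u ⬝ᵥ u) := by
    intro a
    have h1 := integral_centered_mulVec_dotProduct_self_le (h.norm_outer_le a) u
    have h2 := mulVec_dotProduct_self_le (secondMoment (D a) - S) u
    have h3 : ‖secondMoment (D a) - S‖ ^ 2 ≤ (2 * C.V) ^ 2 :=
      pow_le_pow_left₀ (norm_nonneg _) (h.norm_sub_covMatrix_le h0 a) 2
    have h4 : ∀ x : Vec d, ((outer x - S) *ᵥ u) ⬝ᵥ ((outer x - S) *ᵥ u) ≤
        2 * (((outer x - secondMoment (D a)) *ᵥ u) ⬝ᵥ ((outer x - secondMoment (D a)) *ᵥ u)) +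
        2 * (((secondMoment (D a) - S) *ᵥ u) ⬝ᵥ ((secondMoment (D a) - S) *ᵥ u)) := fun x => by
      rw [← sub_add_sub_cancel (outer x) (secondMoment (D a)) S, Matrix.add_mulVec]
      set y := (outer x - secondMoment (D a)) *ᵥ u
      set z := (secondMoment (D a) - S) *ᵥ u
      have h5 : 0 ≤ (y - z) ⬝ᵥ (y - z) := by rw [dotProduct_self_eq_norm_sq]; positivity
      simp only [sub_dotProduct, dotProduct_sub, add_dotProduct, dotProduct_add] at h5 ⊢
      linarith
    have h6 := integral_mono (hI S a) (((hI (secondMoment (D a)) a).const_mul 2).add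
      (integrable_const _)) h4
    refine h6.trans ?_
    refine (integral_add ((hI (secondMoment (D a)) a).const_mul 2)
      (integrable_const _)).trans_le ?_
    rw [integral_const_mul, integral_const, probReal_univ, one_smul]
    have h7 : matVar (D a) outer * (u ⬝ᵥ u) ≤ C.Var * (u ⬝ᵥ u) :=
      mul_le_mul_of_nonneg_right (h.var_le a) hu
    have h8 : ‖secondMoment (D a) - S‖ ^ 2 * (u ⬝ᵥ u) ≤ (2 * C.V) ^ 2 * (u ⬝ᵥ u) :=
      mul_le_mul_of_nonneg_right h3 hu
    have h9 := mul_nonneg C.Var_pos.le hu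
    linarith
  simp only [centeredOuter]
  rw [integral_sampleLaw (h := fun x => ((outer x - S) *ᵥ u) ⬝ᵥ ((outer x - S) *ᵥ u))
    (measurable_comp_of_entries hc (hm S)), integral_mixture (hI S)]
  have h1 := mul_le_mul_of_nonneg_left (hgroup true) hp
  have h2 := mul_le_mul_of_nonneg_left (hgroup false) hp'
  linarith

end Data

/-! ### The iterates: orthonormality, dependence on past samples only, measurability. -/

section FairNPM

variable {d k r : ℕ} {qr : Mat d k → Mat d k}

theorem transpose_mul_fairNPM (hqr : IsQR qr) (B : ℕ) (U : Mat d r) (G : Mat d k)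
    (s : ℕ → Sample d) (τ : ℕ) :
    (fairNPM qr B U G s τ)ᵀ * fairNPM qr B U G s τ = 1 := by
  cases τ <;> exact hqr.orthonormal _

theorem sampleCov_truncate (e : Sample d) {B τ n : ℕ} (h : τ * B ≤ n) (s : ℕ → Sample d) :
    sampleCov B (truncate e n s) τ = sampleCov B s τ := by
  unfold sampleCov
  congr 1
  refine Finset.sum_congr rfl fun j hj => ?_
  have : j < n := (Finset.mem_Ico.1 hj).2.trans_le h
  simp [truncate, this]

/-- This is the predictability of V_τ: only the first τB samples enter. -/
theorem fairNPM_truncate (e : Sample d) (B : ℕ) (U : Mat d r) (G : Mat d k)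
    (s : ℕ → Sample d) {τ n : ℕ} (h : τ * B ≤ n) :
    fairNPM qr B U G (truncate e n s) τ = fairNPM qr B U G s τ := by
  induction τ with
  | zero => rfl
  | succ τ ih =>
    simp only [fairNPM]
    rw [ih ((Nat.mul_le_mul_right B (Nat.le_succ τ)).trans h), sampleCov_truncate e h]

theorem measurable_mul_apply {Ω : Type*} [MeasurableSpace Ω] {a b c : ℕ} {A : Ω → Mat a b}
    {C : Ω → Mat b c} (hA : ∀ i j, Measurable fun ω => A ω i j)
    (hC : ∀ i j, Measurable fun ω => C ω i j) (i : Fin a) (j : Fin c) :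
    Measurable fun ω => (A ω * C ω) i j := by
  simp only [Matrix.mul_apply]
  exact Finset.measurable_sum _ fun x _ => (hA i x).mul (hC x j)

theorem IsQR.measurable_apply (hqr : IsQR qr) {Ω : Type*} [MeasurableSpace Ω] {A : Ω → Mat d k}
    (hA : ∀ i j, Measurable fun ω => A ω i j) (i : Fin d) (j : Fin k) :
    Measurable fun ω => qr (A ω) i j :=
  (hqr.measurable i j).comp (g := fun M : Fin d → Fin k → ℝ => qr (Matrix.of M) i j)
    (f := fun ω i j => A ω i j)
    (measurable_pi_iff.2 fun i => measurable_pi_iff.2 fun j => hA i j)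

theorem measurable_sampleCov_apply (B τ : ℕ) (i j : Fin d) :
    Measurable fun s : ℕ → Sample d => sampleCov B s τ i j := by
  simp only [sampleCov, Matrix.smul_apply, Matrix.sum_apply, smul_eq_mul]
  refine (Finset.measurable_sum _ fun a _ => ?_).const_mul _
  exact (measurable_outer_apply i j).comp (measurable_snd.comp (measurable_pi_apply a))

theorem measurable_fairNPM_apply (hqr : IsQR qr) (B : ℕ) (U : Mat d r) (τ : ℕ) (i : Fin d)
    (j : Fin k) : Measurable fun ω : (Fin d → Fin k → ℝ) × (ℕ → Sample d) =>
      fairNPM qr B U (Matrix.of ω.1) ω.2 τ i j := by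
  induction τ generalizing i j with
  | zero =>
    simp only [fairNPM]
    refine hqr.measurable_apply (fun i j => ?_) i j
    simp only [Matrix.of_apply]
    fun_prop
  | succ τ ih =>
    have hres : ∀ {A : (Fin d → Fin k → ℝ) × (ℕ → Sample d) → Mat d k},
        (∀ i j, Measurable fun ω => A ω i j) →
        ∀ i j, Measurable fun ω => (A ω - U * Uᵀ * A ω) i j := fun hA i j => by
      simp only [Matrix.sub_apply]
      exact (hA i j).sub (measurable_mul_apply (A := fun _ => U * Uᵀ)
        (fun _ _ => measurable_const) hA i j)
    simp only [fairNPM]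
    exact hqr.measurable_apply (hres (measurable_mul_apply
      (fun a b => (measurable_sampleCov_apply B (τ + 1) a b).comp measurable_snd) (hres ih))) i j

end FairNPM

/-! ### From the block size to the Bernstein exponent. -/

section Numerics

/-- Here v = Var + V², with Bernstein parameters w = 8v and L = M + 2V. The Gaussian regime is
immediate. In the linear regime, 2M/t ≤ v/t² + M²/v by AM-GM, and V/t is absorbed by v/t² because t
≤ V/4 and V² ≤ v. -/
theorem mul_le_mul_min {v V M t B Λ K : ℝ} (hV : 0 < V) (hM : 0 < M) (hv : V ^ 2 ≤ v)
    (ht : 0 < t) (htV : t ≤ V / 4) (hΛ : 0 ≤ Λ) (hK : 0 ≤ K)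
    (hB : K * (v / t ^ 2 + M ^ 2 / v) * Λ ≤ B) :
    K / 32 * Λ ≤ B * min (t ^ 2 / (4 * (8 * v))) (t / (2 * (M + 2 * V))) := by
  have hv0 : 0 < v := lt_of_lt_of_le (by positivity) hv
  have hB0 : 0 ≤ B := le_trans (by positivity) hB
  rw [mul_min_of_nonneg _ _ hB0]
  have hKL : 0 ≤ K * Λ := mul_nonneg hK hΛ
  refine le_min ?_ ?_
  · have h1 : K * (v / t ^ 2) * Λ ≤ B := by
      refine le_trans ?_ hB
      gcongr
      exact le_add_of_nonneg_right (by positivity)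
    calc K / 32 * Λ = K * (v / t ^ 2) * Λ * (t ^ 2 / (4 * (8 * v))) := by field_simp; ring
      _ ≤ _ := by gcongr
  · have h2 : (M + 2 * V) / t ≤ v / t ^ 2 + M ^ 2 / v := by
      have h3 : 2 * (M / t) ≤ v / t ^ 2 + M ^ 2 / v := by
        have h4 : v / t ^ 2 + M ^ 2 / v - 2 * (M / t) = (v / t - M) ^ 2 / v := by
          field_simp; ring
        have : 0 ≤ (v / t - M) ^ 2 / v := by positivity
        linarith
      have h5 : 4 * (V / t) ≤ v / t ^ 2 := by
        calc 4 * (V / t) ≤ V / t * (V / t) := by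
              rw [mul_comm]; gcongr; rw [le_div_iff₀ ht]; linarith
          _ = V ^ 2 / t ^ 2 := by ring
          _ ≤ v / t ^ 2 := by gcongr
      have h6 : 0 ≤ M ^ 2 / v := by positivity
      have h7 : (M + 2 * V) / t = M / t + 2 * (V / t) := by ring
      linarith
    have h1 : K * ((M + 2 * V) / t) * Λ ≤ B := le_trans (by gcongr) hB
    calc K / 32 * Λ ≤ K / 2 * Λ := by gcongr; norm_num
      _ = K * ((M + 2 * V) / t) * Λ * (t / (2 * (M + 2 * V))) := by field_simp
      _ ≤ _ := by gcongr

theorem add_self_mul_exp_neg_le {n δ x : ℝ} (hn : 0 < n) (hδ : 0 < δ)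
    (hx : Real.log (4 * n / δ) ≤ x) : (n + n) * Real.exp (-x) ≤ δ / 2 := by
  have h1 : Real.exp (-x) ≤ (4 * n / δ)⁻¹ := by
    rw [Real.exp_neg]
    gcongr
    exact (Real.log_le_iff_le_exp (by positivity)).1 hx
  calc (n + n) * Real.exp (-x) ≤ (n + n) * (4 * n / δ)⁻¹ := by gcongr
    _ = δ / 2 := by field_simp; ring

theorem log_le_natCast_mul_log {a b : ℝ} (ha : 0 < a) {n : ℕ} (h : a ≤ b ^ n) :
    Real.log a ≤ n * Real.log b := by
  rw [← Real.log_pow]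
  exact Real.log_le_log ha h

theorem log_four_mul_div_le {d δ : ℝ} (hd : 2 ≤ d) (hδ : 0 < δ) (hδ1 : δ < 1) :
    Real.log (4 * d / δ) ≤ 3 * Real.log (d / δ) := by
  have h2 : 2 ≤ d / δ := by rw [le_div_iff₀ hδ]; nlinarith
  have := log_le_natCast_mul_log (a := 4 * d / δ) (b := d / δ) (n := 3) (by positivity) (by
      rw [mul_div_assoc, pow_succ]
      gcongr
      nlinarith)
  exact_mod_cast this

theorem log_four_mul_div_le_two_mul {k δ : ℝ} (hk : 1 ≤ k) (hδ : 0 < δ) (hδ1 : δ < 1) :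
    Real.log (4 * k / δ) ≤ 2 * Real.log (2 * k / δ) := by
  have h2 : 2 ≤ 2 * k / δ := by rw [le_div_iff₀ hδ]; nlinarith
  have := log_le_natCast_mul_log (a := 4 * k / δ) (b := 2 * k / δ) (n := 2) (by positivity) (by
      rw [show 4 * k / δ = 2 * (2 * k / δ) by ring, pow_two]
      gcongr)
  exact_mod_cast this

/-- The M² term of the block size carries only log(d/δ); this lets it also pay for the k-dimensional
event. -/
theorem log_two_mul_div_le {k d δ : ℝ} (hd : 2 ≤ d) (hk : 1 ≤ k) (hkd : k ≤ d) (hδ : 0 < δ)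
    (hδ1 : δ < 1) : Real.log (2 * k / δ) ≤ 2 * Real.log (d / δ) := by
  have h2 : 2 ≤ d / δ := by rw [le_div_iff₀ hδ]; nlinarith
  have := log_le_natCast_mul_log (a := 2 * k / δ) (b := d / δ) (n := 2) (by positivity) (by
      rw [mul_div_assoc, pow_two]
      gcongr)
  exact_mod_cast this

end Numerics

/-! ### Decomposition of the noise and concentration of its statistical part. -/

section Concentration

variable {d m k r : ℕ} {D : Bool → Measure (Vec d)} {p : Set.Ioo (0 : ℝ) 1} {P : Mat d m}
  {C : DataConstants}

theorem sum_centeredOuter {l r : ℕ} {B τ : ℕ} (hB : B ≠ 0) (hτ : 1 ≤ τ) (s : ℕ → Sample d)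
    (A : Mat d l) (R : Mat d r) :
    ∑ j ∈ Finset.Ico ((τ - 1) * B) ((τ - 1) * B + B), Aᵀ * centeredOuter D p (s j) * R =
      (B : ℝ) • (Aᵀ * (sampleCov B s τ - covMatrix (mixture D p)) * R) := by
  -- Needs τ ≥ 1, because τ - 1 is truncated subtraction.
  have hblock : Finset.Ico ((τ - 1) * B) ((τ - 1) * B + B) = block B τ := by
    unfold block
    congr 1
    obtain ⟨t, rfl⟩ := Nat.exists_eq_add_of_le hτ
    rw [Nat.add_sub_cancel_left]; ring
  have hcard : (block B τ).card = B := by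
    rw [← hblock, Nat.card_Ico, Nat.add_sub_cancel_left]
  have hB0 : (B : ℝ) ≠ 0 := Nat.cast_ne_zero.2 hB
  rw [hblock, ← Matrix.sum_mul, ← Matrix.mul_sum, ← Matrix.smul_mul, ← Matrix.mul_smul]
  congr 2
  simp only [centeredOuter]
  rw [Finset.sum_sub_distrib, Finset.sum_const, hcard, smul_sub, sampleCov, smul_smul,
    mul_inv_cancel₀ hB0, one_smul, Nat.cast_smul_eq_nsmul]

variable [∀ a, IsProbabilityMeasure (D a)]

/-- Stated for general predictable contractions A, R with n columns, so that one lemma covers n = d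
with A = R = 1 and n = k with A = Π'Q, R = Π'V. -/
theorem DataAssumption.measure_norm_sampleCov_sub_ge_le (h : DataAssumption C D p P)
    (h0 : mean (mixture D p) = 0) {n : ℕ} (hn : 1 ≤ n) {B τ : ℕ} (hB0 : B ≠ 0) (hτ : 1 ≤ τ)
    {A R : (ℕ → Sample d) → Mat d n}
    (hAm : ∀ i j, Measurable fun s => A s i j) (hRm : ∀ i j, Measurable fun s => R s i j)
    (hA : ∀ s, ‖A s‖ ≤ 1) (hR : ∀ s, ‖R s‖ ≤ 1)
    (hAt : ∀ s, A (truncate (false, 0) ((τ - 1) * B) s) = A s)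
    (hRt : ∀ s, R (truncate (false, 0) ((τ - 1) * B) s) = R s)
    {t Λ K δ : ℝ} (ht : 0 < t) (htV : t ≤ C.V / 4) (hΛ : 0 ≤ Λ) (hK : 0 ≤ K) (hδ : 0 < δ)
    (hB : K * ((C.Var + C.V ^ 2) / t ^ 2 + C.M ^ 2 / (C.Var + C.V ^ 2)) * Λ ≤ B)
    (hlog : Real.log (4 * n / δ) ≤ K / 32 * Λ) :
    (Measure.infinitePi fun _ => sampleLaw D p) {s | t ≤
        ‖(A s)ᵀ * (sampleCov B s τ - covMatrix (mixture D p)) * R s‖} ≤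
      ENNReal.ofReal (δ / 2) := by
  have : Nonempty (Fin n) := ⟨⟨0, hn⟩⟩
  have hV := C.V_pos
  have hM := C.M_pos
  have hVar := C.Var_pos
  have hb := matrix_bernstein (ν := sampleLaw D p) (false, 0) ((τ - 1) * B)
    measurable_centeredOuter_apply transpose_centeredOuter (L := C.M + 2 * C.V)
    (w := 8 * (C.Var + C.V ^ 2)) (by positivity) (by positivity) (h.norm_centeredOuter_le h0)
    (h.integral_centeredOuter h0) (h.integral_centeredOuter_sq_le h0) hAm hRm hA hR hAt hRt ht B
  have hBpos : (0 : ℝ) < B := Nat.cast_pos.2 (Nat.pos_of_ne_zero hB0)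
  refine le_trans (measure_mono fun s hs => ?_) (hb.trans (ENNReal.ofReal_le_ofReal ?_))
  · rw [Set.mem_ofPred_eq, sum_centeredOuter hB0 hτ, norm_smul, Real.norm_of_nonneg hBpos.le]
    exact mul_le_mul_of_nonneg_left hs hBpos.le
  · rw [Fintype.card_fin]
    exact add_self_mul_exp_neg_le (by exact_mod_cast hn) hδ
      (hlog.trans (mul_le_mul_min hV hM (by linarith) ht htV hΛ hK hB))

theorem noise_eq {qr : Mat d k → Mat d k} (B : ℕ) (U' : Mat d r) (S A : Mat d d) (G : Mat d k)
    (s : ℕ → Sample d) (τ : ℕ) :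
    noise qr B U' A G s τ =
      projPerp U' * ((sampleCov B s τ - S) * (projPerp U' * fairNPM qr B U' G s (τ - 1))) +
        (projPerp U' * S * projPerp U' - A) * fairNPM qr B U' G s (τ - 1) := by
  rw [noise]
  simp only [Matrix.mul_sub, Matrix.sub_mul, Matrix.mul_assoc]
  abel

theorem norm_noise_le {qr : Mat d k → Mat d k} (hqr : IsQR qr) (B : ℕ) {U' : Mat d r}
    (hU : ‖projPerp U'‖ ≤ 1) (S A : Mat d d) (G : Mat d k) (s : ℕ → Sample d) (τ : ℕ) :
    ‖noise qr B U' A G s τ‖ ≤ ‖sampleCov B s τ - S‖ + ‖projPerp U' * S * projPerp U' - A‖ := by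
  have hV := norm_le_one_of_transpose_mul_self (transpose_mul_fairNPM hqr B U' G s (τ - 1))
  rw [noise_eq B U' S]
  refine (norm_add_le _ _).trans (add_le_add ?_ (norm_mul_le_of_le_one_right _ hV))
  refine (norm_mul_le_of_le_one_left hU _).trans (norm_mul_le_of_le_one_right _ ?_)
  exact (norm_mul_le_of_le_one_left hU _).trans hV

/-- The factors Q and V stay inside the first norm, so that it concerns a k × k matrix. -/
theorem norm_transpose_mul_noise_le {qr : Mat d k → Mat d k} (hqr : IsQR qr) (B : ℕ)
    {U' : Mat d r} {Q : Mat d k} (hQ : ‖Q‖ ≤ 1) (S A : Mat d d) (G : Mat d k)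
    (s : ℕ → Sample d) (τ : ℕ) :
    ‖Qᵀ * noise qr B U' A G s τ‖ ≤
      ‖(projPerp U' * Q)ᵀ * (sampleCov B s τ - S) *
        (projPerp U' * fairNPM qr B U' G s (τ - 1))‖ +
      ‖projPerp U' * S * projPerp U' - A‖ := by
  have hV := norm_le_one_of_transpose_mul_self (transpose_mul_fairNPM hqr B U' G s (τ - 1))
  rw [noise_eq B U' S, Matrix.mul_add, Matrix.transpose_mul, transpose_projPerp]
  refine (norm_add_le _ _).trans (add_le_add (le_of_eq ?_) ?_)
  · simp only [Matrix.mul_assoc]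
  · exact (norm_mul_le_of_le_one_left (by rwa [norm_transpose]) _).trans
      (norm_mul_le_of_le_one_right _ hV)

/-- Union bound over the two events for each fixed Gaussian start, then Fubini. The requirement K ≥
96 comes from K/32 ≥ 3, the factor lost between log(4d/δ) and log(d/δ). Measurability is part of the
conclusion because the complement is taken afterwards. -/
theorem DataAssumption.fairNPMLaw_sampleCov_ge_le (h : DataAssumption C D p P)
    (h0 : mean (mixture D p) = 0) (hk : 1 ≤ k) (hkd : k < d) {qr : Mat d k → Mat d k}
    (hqr : IsQR qr) {B τ : ℕ} (hB0 : B ≠ 0) (hτ : 1 ≤ τ) {U' : Mat d r} (hU : ‖projPerp U'‖ ≤ 1)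
    {Q : Mat d k} (hQ : ‖Q‖ ≤ 1) {t₁ t₂ K δ : ℝ} (ht₁ : 0 < t₁) (ht₁V : t₁ ≤ C.V / 4)
    (ht₂ : 0 < t₂) (ht₂V : t₂ ≤ C.V / 4) (hK : 96 ≤ K) (hδ : 0 < δ) (hδ1 : δ < 1)
    (hB₁ : K * ((C.Var + C.V ^ 2) / t₁ ^ 2 + C.M ^ 2 / (C.Var + C.V ^ 2)) * Real.log (d / δ) ≤ B)
    (hB₂ : K * ((C.Var + C.V ^ 2) / t₂ ^ 2 + C.M ^ 2 / (C.Var + C.V ^ 2)) *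
      Real.log (2 * k / δ) ≤ B) :
    fairNPMLaw k D p {ω | t₁ ≤ ‖sampleCov B ω.2 τ - covMatrix (mixture D p)‖ ∨
      t₂ ≤ ‖(projPerp U' * Q)ᵀ * (sampleCov B ω.2 τ - covMatrix (mixture D p)) *
        (projPerp U' * fairNPM qr B U' (Matrix.of ω.1) ω.2 (τ - 1))‖} ≤ ENNReal.ofReal δ ∧
    MeasurableSet {ω : (Fin d → Fin k → ℝ) × (ℕ → Sample d) |
      t₁ ≤ ‖sampleCov B ω.2 τ - covMatrix (mixture D p)‖ ∨
      t₂ ≤ ‖(projPerp U' * Q)ᵀ * (sampleCov B ω.2 τ - covMatrix (mixture D p)) *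
        (projPerp U' * fairNPM qr B U' (Matrix.of ω.1) ω.2 (τ - 1))‖} := by
  have hk1 : (1 : ℝ) ≤ k := by exact_mod_cast hk
  have hd2 : (2 : ℝ) ≤ d := by
    have : 2 ≤ d := by omega
    exact_mod_cast this
  have hΛ₁ : 0 ≤ Real.log (d / δ) := Real.log_nonneg (by rw [le_div_iff₀ hδ]; linarith)
  have hΛ₂ : 0 ≤ Real.log (2 * k / δ) := Real.log_nonneg (by rw [le_div_iff₀ hδ]; linarith)
  have hVm := fun i j => measurable_fairNPM_apply hqr B U' (τ - 1) i j
  have hRm := fun i j => measurable_mul_apply (A := fun _ => projPerp U')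
    (fun _ _ => measurable_const) hVm i j
  have hSm : ∀ i j, Measurable fun ω : (Fin d → Fin k → ℝ) × (ℕ → Sample d) =>
      (sampleCov B ω.2 τ - covMatrix (mixture D p)) i j := fun i j => by
    simp only [Matrix.sub_apply]
    exact ((measurable_sampleCov_apply B τ i j).comp measurable_snd).sub_const _
  have hmeas : MeasurableSet {ω : (Fin d → Fin k → ℝ) × (ℕ → Sample d) |
      t₁ ≤ ‖sampleCov B ω.2 τ - covMatrix (mixture D p)‖ ∨
      t₂ ≤ ‖(projPerp U' * Q)ᵀ * (sampleCov B ω.2 τ - covMatrix (mixture D p)) *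
        (projPerp U' * fairNPM qr B U' (Matrix.of ω.1) ω.2 (τ - 1))‖} := by
    refine (measurableSet_le measurable_const (measurable_comp_of_entries continuous_norm hSm)).union
      (measurableSet_le measurable_const (measurable_comp_of_entries continuous_norm ?_))
    exact measurable_mul_apply (measurable_mul_apply (A := fun _ => (projPerp U' * Q)ᵀ)
      (fun _ _ => measurable_const) hSm) hRm
  refine ⟨?_, hmeas⟩
  rw [fairNPMLaw, Measure.prod_apply hmeas]
  refine (lintegral_mono (g := fun _ => ENNReal.ofReal δ) fun G => ?_).trans_eq (by simp)
  have h1 := h.measure_norm_sampleCov_sub_ge_le h0 (n := d) (by omega) hB0 hτ (A := fun _ => 1)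
    (R := fun _ => 1) (fun _ _ => measurable_const) (fun _ _ => measurable_const)
    (fun _ => norm_le_one_of_transpose_mul_self (by simp))
    (fun _ => norm_le_one_of_transpose_mul_self (by simp)) (fun _ => rfl) (fun _ => rfl)
    ht₁ ht₁V hΛ₁ (by linarith) hδ hB₁
    ((log_four_mul_div_le hd2 hδ hδ1).trans (by gcongr; linarith))
  have h2 := h.measure_norm_sampleCov_sub_ge_le h0 (n := k) hk hB0 hτ
    (A := fun _ => projPerp U' * Q)
    (R := fun s => projPerp U' * fairNPM qr B U' (Matrix.of G) s (τ - 1))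
    (fun _ _ => measurable_const) (fun i j => (hRm i j).comp measurable_prodMk_left)
    (fun _ => (norm_mul_le_of_le_one_left hU _).trans hQ)
    (fun s => (norm_mul_le_of_le_one_left hU _).trans
      (norm_le_one_of_transpose_mul_self (transpose_mul_fairNPM hqr B U' _ s (τ - 1))))
    (fun _ => rfl) (fun s => by rw [fairNPM_truncate (false, 0) B U' _ s le_rfl])
    ht₂ ht₂V hΛ₂ (by linarith) hδ hB₂
    ((log_four_mul_div_le_two_mul hk1 hδ hδ1).trans (by gcongr; linarith))
  simp only [Matrix.transpose_one, Matrix.one_mul, Matrix.mul_one] at h1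
  refine (measure_union_le _ _).trans ((add_le_add h1 h2).trans_eq ?_)
  rw [← ENNReal.ofReal_add (by positivity) (by positivity), add_halves]

end Concentration

end FairPCA

/-! ### The claim. -/

open FairPCA
theorem mainTheorem3 :
    -- an absolute constant, hidden in the `Ω`
    ∃ c : ℝ, 0 < c ∧
    ∀ (d m k : ℕ) (_ : 1 ≤ m) (_ : m < d) (_ : 1 ≤ k) (_ : k < d)
      -- QR decomposition routines for `d × m` and `d × k` matrices
      (qrm : Mat d m → Mat d m) (_ : IsQR qrm) (qrk : Mat d k → Mat d k) (_ : IsQR qrk)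
      -- the group distributions, the group probability; the data are centered
      (D : Bool → Measure (Vec d)) [∀ a, IsProbabilityMeasure (D a)] (p : Set.Ioo (0 : ℝ) 1)
      (_ : mean (mixture D p) = 0)
      (P : Mat d m) (_ : IsTopEigenvectors (momentGap D) P)
      (C₁ : DataConstants) (_ : DataAssumption C₁ D p P)
      (C₂ : SpectralConstants) (_ : SpectralAssumption C₂ k D p P)
      (Q : Mat d k) (_ : IsTopEigenvectors (fairCov D p P) Q)
      (ε δ : ℝ) (_ : ε ∈ Set.Ioo (0 : ℝ) 1) (_ : δ ∈ Set.Ioo (0 : ℝ) 1)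
      -- a run of the first algorithm, with output `Û`
      (b T : ℕ) (G₁ : Mat d m) (s₁ : ℕ → Sample d)
      (_ : ‖proj (unfairSubspace qrm b T G₁ s₁).2 - proj (unfairBasis D P).2‖ ≤
        C₂.Δκ / (20 * C₁.V) * min ε (δ / (2 * √(d * k))))
      -- the block size of the second algorithm
      (B : ℕ)
      (_ : c * ((C₁.Var + C₁.V ^ 2) / C₂.Δκ ^ 2 *
            (d * k / δ ^ 2 * Real.log (2 * k / δ) + 1 / ε ^ 2 * Real.log (d / δ)) +
          C₁.M ^ 2 / (C₁.Var + C₁.V ^ 2) * Real.log (d / δ)) ≤ B)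
      (τ : ℕ) (_ : 1 ≤ τ),
      ENNReal.ofReal (1 - δ) ≤ fairNPMLaw k D p {ω |
        5 * ‖noise qrk B (unfairSubspace qrm b T G₁ s₁).2 (fairCov D p P)
              (Matrix.of ω.1) ω.2 τ‖ ≤ ε * C₂.Δκ ∧
        5 * ‖Qᵀ * noise qrk B (unfairSubspace qrm b T G₁ s₁).2 (fairCov D p P)
              (Matrix.of ω.1) ω.2 τ‖ ≤ δ * C₂.Δκ / (2 * √(d * k))} := by
  refine ⟨100000, by norm_num, ?_⟩
  intro d m k hm hmd hk hkd qrm hqrm qrk hqrk D _ p h0 P hP C₁ hC₁ C₂ hC₂ Q hQ ε δ hε hδ b T G₁ s₁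
    hU B hB τ hτ
  obtain ⟨hε0, hε1⟩ := hε
  obtain ⟨hδ0, hδ1⟩ := hδ
  -- Even for T = 0 the iterate W_T is a QR factor, so Û has orthonormal columns.
  have hU'1 : (unfairSubspace qrm b T G₁ s₁).2ᵀ * (unfairSubspace qrm b T G₁ s₁).2 = 1 := by
    refine transpose_mul_adjoin (W := (unfairState qrm b G₁ s₁ T).W) ?_ _
    cases T <;> exact hqrm.orthonormal _
  have hV := C₁.V_pos
  have hM := C₁.M_pos
  have hVar := C₁.Var_pos
  have hΔ := C₂.Δκ_pos
  have hS := hC₁.norm_covMatrix_mixture_le h0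
  have hpU : ‖projPerp (unfairBasis D P).2‖ ≤ 1 :=
    norm_projPerp_le_one (transpose_mul_adjoin hP.1 _)
  have hpU' := norm_projPerp_le_one hU'1
  -- The gap is at most κ_k ≤ ‖ΠΣΠ‖ ≤ ‖Σ‖ ≤ V. This keeps both thresholds below V/4.
  have hΔV : C₂.Δκ ≤ C₁.V := by
    have h1 := hC₂.gap_κ
    have h2 := singVal_le_norm hQ hk le_rfl
    have h3 := singVal_nonneg (fairCov D p P) (k + 1)
    have h4 : ‖fairCov D p P‖ ≤ ‖covMatrix (mixture D p)‖ :=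
      (norm_mul_le_of_le_one_right _ hpU).trans (norm_mul_le_of_le_one_left hpU _)
    linarith
  generalize (unfairSubspace qrm b T G₁ s₁).2 = U' at *
  have hk1 : (1 : ℝ) ≤ k := by exact_mod_cast hk
  have hd2 : (2 : ℝ) ≤ d := by
    have : 2 ≤ d := by omega
    exact_mod_cast this
  have hkd' : (k : ℝ) ≤ d := by exact_mod_cast hkd.le
  have hq1 : 1 ≤ √((d : ℝ) * k) := Real.one_le_sqrt.2 (by nlinarith)
  have hqsq : √((d : ℝ) * k) ^ 2 = d * k := Real.sq_sqrt (by positivity)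
  have hΛ₁ : 0 < Real.log (d / δ) := Real.log_pos (by rw [lt_div_iff₀ hδ0]; linarith)
  have hΛ₂ : 0 < Real.log (2 * k / δ) := Real.log_pos (by rw [lt_div_iff₀ hδ0]; linarith)
  have hΛ₂₁ := log_two_mul_div_le hd2 hk1 hkd' hδ0 hδ1
  set q := √((d : ℝ) * k) with hq
  set Λ₁ := Real.log (d / δ)
  set Λ₂ := Real.log (2 * k / δ)
  set v := C₁.Var + C₁.V ^ 2 with hv
  have hv0 : 0 < v := by positivity
  have hB0 : B ≠ 0 := by
    have : (0 : ℝ) < B := lt_of_lt_of_le (by positivity) hB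
    exact_mod_cast this.ne'
  have hgap : ‖projPerp U' * covMatrix (mixture D p) * projPerp U' - fairCov D p P‖ ≤
      C₂.Δκ / 10 * min ε (δ / (2 * q)) := by
    have h1 := norm_conj_sub_conj_le hpU hpU' (covMatrix (mixture D p))
    have h2 : ‖projPerp U' - projPerp (unfairBasis D P).2‖ ≤
        C₂.Δκ / (20 * C₁.V) * min ε (δ / (2 * q)) := by
      rw [norm_sub_rev]
      simpa [projPerp] using hU
    calc _ ≤ _ := h1
      _ ≤ 2 * C₁.V * (C₂.Δκ / (20 * C₁.V) * min ε (δ / (2 * q))) := by gcongr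
      _ = _ := by field_simp; ring
  -- The thresholds t₁ and t₂ equal the two bounds on the bias, so statistical error and bias each
  -- use half of the budget after multiplication by 5. With K = 100, t₁ costs 100·100 and t₂ costs
  -- 100·400 in front of v/Δ², and the constant 100000 covers both.
  obtain ⟨hbad, hmeas⟩ := hC₁.fairNPMLaw_sampleCov_ge_le h0 hk hkd hqrk hB0 hτ hpU'
    (norm_le_one_of_transpose_mul_self hQ.1) (t₁ := ε * C₂.Δκ / 10)
    (t₂ := δ * C₂.Δκ / (20 * q)) (K := 100) (δ := δ) (by positivity) (by nlinarith) (by positivity)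
    (by
      rw [div_le_iff₀ (by positivity)]
      nlinarith) (by norm_num) hδ0 hδ1
    (by
      refine le_trans ?_ hB
      have h1 : v / (ε * C₂.Δκ / 10) ^ 2 = 100 * (v / C₂.Δκ ^ 2 * (1 / ε ^ 2)) := by
        field_simp; norm_num
      have h2 : 0 ≤ v / C₂.Δκ ^ 2 * (1 / ε ^ 2) * Λ₁ := by positivity
      have h3 : 0 ≤ C₁.M ^ 2 / v * Λ₁ := by positivity
      have h4 : 0 ≤ v / C₂.Δκ ^ 2 * (d * k / δ ^ 2 * Λ₂) := by positivity
      rw [← hv, h1]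
      linarith)
    (by
      refine le_trans ?_ hB
      have h1 : v / (δ * C₂.Δκ / (20 * q)) ^ 2 = 400 * (v / C₂.Δκ ^ 2 * (d * k / δ ^ 2)) := by
        rw [← hqsq]; field_simp; norm_num
      have h2 : 0 ≤ v / C₂.Δκ ^ 2 * (1 / ε ^ 2 * Λ₁) := by positivity
      have h3 : C₁.M ^ 2 / v * Λ₂ ≤ C₁.M ^ 2 / v * (2 * Λ₁) := by gcongr
      have h4 : 0 ≤ v / C₂.Δκ ^ 2 * (d * k / δ ^ 2 * Λ₂) := by positivity
      have h5 : 0 ≤ C₁.M ^ 2 / v * Λ₁ := by positivity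
      rw [← hv, h1]
      linarith)
  have hprob : IsProbabilityMeasure (fairNPMLaw k D p) := by
    unfold fairNPMLaw
    infer_instance
  calc ENNReal.ofReal (1 - δ) = 1 - ENNReal.ofReal δ := by
        rw [ENNReal.ofReal_sub _ hδ0.le, ENNReal.ofReal_one]
    _ ≤ 1 - fairNPMLaw k D p _ := tsub_le_tsub_left hbad 1
    _ = fairNPMLaw k D p _ := (prob_compl_eq_one_sub hmeas).symm
    _ ≤ _ := by
        refine measure_mono fun ω hω => ?_
        simp only [Set.mem_compl_iff, Set.mem_ofPred_eq, not_or, not_le] at hω ⊢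
        have h1 := norm_noise_le hqrk B hpU' (covMatrix (mixture D p)) (fairCov D p P)
          (Matrix.of ω.1) ω.2 τ
        have h2 := norm_transpose_mul_noise_le hqrk B (U' := U')
          (norm_le_one_of_transpose_mul_self hQ.1)
          (covMatrix (mixture D p)) (fairCov D p P) (Matrix.of ω.1) ω.2 τ
        have h3 : C₂.Δκ / 10 * min ε (δ / (2 * q)) ≤ C₂.Δκ / 10 * ε := by
          gcongr; exact min_le_left _ _
        have h4 : C₂.Δκ / 10 * min ε (δ / (2 * q)) ≤ C₂.Δκ / 10 * (δ / (2 * q)) := by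
          gcongr; exact min_le_right _ _
        have h5 : C₂.Δκ / 10 * (δ / (2 * q)) = δ * C₂.Δκ / (20 * q) := by field_simp; norm_num
        have h6 : δ * C₂.Δκ / (2 * q) = 10 * (δ * C₂.Δκ / (20 * q)) := by field_simp; norm_num
        refine ⟨?_, ?_⟩
        · linarith [hω.1]
        · rw [h6]
          linarith [hω.2]
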